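/- **Setting.** Consider a power network on a connected undirected graph $\mathcal G=(\mathcal I,\mathcal E)$ with $n$ buses, $m$ oriented lines and incidence matrix $D\in\mathbb R^{m\times n}$ ($+1$ at the positive end of a line, $-1$ at the negative end); inertias $M_i\ge 0$ (at least one positive), dampings $E_i>0$, line susceptances $b_e>0$ with $Y_b=\mathrm{diag}(b_e)$; controlled buses $\mathcal I^u\subseteq\mathcal I$, with filter constants $\tau_i>0$ and bounds $\epsilon_i>0$ for $i\in\mathcal I^u$; safety buses $\mathcal I^\omega\subseteq\mathcal I^u$, with frequency bounds $\underline\omega_i<\bar\omega_i$ and penalties $d_i>0$ for $i\in\mathcal I^\omega$; and costs $c_i>0$ for all $i\in\mathcal I$. Write $x=(\lambda,\omega,\alpha)\in\mathbb R^{m+2n}$, and let $\tilde G\dot x=\tilde Ax+\tilde B_1p+\tilde B_2u$ denote the system $$\dot\lambda=D\omega,\qquad M\dot\omega=-E\omega-D^TY_b\lambda+p+\alpha,$$ $$M_i\dot\alpha_i=-\tfrac1{\tau_i}\alpha_i-\omega_i+u_i\ (i\in\mathcal I^u),\qquad 0=-\alpha_i+u_i\ (i\notin\mathcal I^u).$$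 Fix a step $T>0$ and put (backward Euler) $F=\tilde G-T\tilde A$, $B_s=T\tilde B_s$ for $s=1,2$, and $A=\tilde G$ or $A=I$. Fix a horizon $N\ge 2$, a forecast $\hat p(1),\dots,\hat p(N)\in\mathbb R^n$ and a sampled state $x^0=(\lambda^0,\omega^0,\alpha^0)\in\mathbb R^{m+2n}$. The problem $\mathbf R^{\text{aug}}$ minimizes over $Y=(\hat X,\hat u,S)$, with $\hat X=(\hat x(k))_{k=1}^N$, $\hat x(k)=(\hat\lambda(k),\hat\omega(k),\hat\alpha(k))$, $\hat u\in\mathbb R^n$ and $S=(s_i(k))_{1\le k\le N,\,i\in\mathcal I^\omega}$, the function $$g^{\text{aug}}(Y)=\sum_{k=1}^{N-1}\|F\hat x(k+1)-A\hat x(k)-B_1\hat p(k)-B_2\hat u\|^2+\sum_{k=1}^N\Big(\sum_{i\in\mathcal I}c_i\hat\alpha_i(k)^2+\sum_{i\in\mathcal I^\omega}d_is_i(k)^2\Big)+\|\hat x(1)-x^0\|^2$$ subject to * $F\hat x(k+1)=A\hat x(k)+B_1\hat p(k)+B_2\hat u$ for $1\le k\le N-1$; * $\hat x(1)=x^0$;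 * $\hat u_i=0$ for $i\notin\mathcal I^u$; * $\underline\omega_i-s_i(k)\le\hat\omega_i(k)\le\bar\omega_i+s_i(k)$ for $i\in\mathcal I^\omega$, $1\le k\le N$; * $|\hat u_i|\le\epsilon_i|\alpha^0_i|$ for $i\in\mathcal I^u$. Write the inequality constraints as $R_1Y\le r_1$ (each two-sided bound as two affine inequalities) and the equality constraints as $R_2Y=r_2$, with multipliers $\eta\ge0$ and $\mu$, and let $\mathfrak L(Y,\eta,\mu)=g^{\text{aug}}(Y)+\eta^T(R_1Y-r_1)+\mu^T(R_2Y-r_2)$. For $\epsilon_Z,\epsilon_\eta,\epsilon_\mu>0$ the projected saddle-point dynamics are $$\epsilon_Z\dot Z=-\nabla_Z\mathfrak L(Z,\eta,\mu),\qquad \epsilon_\eta\dot\eta=[R_1Z-r_1]^+_\eta,\qquad \epsilon_\mu\dot\mu=R_2Z-r_2,$$ where, componentwise, $[a]^+_b=a$ if $b>0$ and $[a]^+_b=\max\{a,0\}$ if $b\le 0$. Solutions on $[0,\infty)$ are understood in the Carathéodory sense (locally absolutely continuous, satisfying the equations at almost every time). **Theorem.** 1. $g^{\text{aug}}$ is strongly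 convex, and $\mathbf R^{\text{aug}}$ has a unique optimal solution $Y^*$. 2. From every initial condition $(Z(0),\eta(0),\mu(0))$ with $\eta(0)\ge0$ there is a solution of the dynamics on $[0,\infty)$. Along every such solution $Z(t)\to Y^*$ as $t\to\infty$; moreover the whole trajectory converges to some saddle point $(Y^*,\eta^*,\mu^*)$ of $\mathfrak L$ on $\{\eta\ge0\}$, and every such saddle point is Lyapunov stable for the dynamics. 3. Let the agents be the buses and the lines, a bus and a line being adjacent when they are incident. Assign $\hat\omega_i(k),\hat\alpha_i(k),\hat u_i,s_i(k)$ to bus $i$, assign $\hat\lambda_e(k)$ to line $e$, and assign each multiplier to the bus or line of its constraint (for the prediction model and the initial condition, that of the corresponding row). Then the right-hand side for each entry of $Z$ depends only on primal and dual variables of agents at distance at most $2$ from its own agent, and the right-hand side for each entry of $\eta$ or $\mu$ only on those of agents at distance at most $1$. -/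

import Mathlib

open scoped Matrix

noncomputable section

/-- A power network on a connected undirected graph with buses `V` and transmission lines
`G.edgeSet`, together with the design parameters of the predictive controller. -/
structure PowerNetwork {V : Type*} [Fintype V] [DecidableEq V] (G : SimpleGraph V) where
  connected : G.Connected
  /-- positive end of each line -/
  posEnd : G.edgeSet → V
  /-- negative end of each line -/
  negEnd : G.edgeSet → V
  ends : ∀ e : G.edgeSet, s(posEnd e, negEnd e) = (e : Sym2 V)
  /-- bus inertia; individual buses may have zero inertia -/
  M : V → ℝ
  M_nonneg : ∀ i, 0 ≤ M i
  M_pos : ∃ i, 0 < M i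
  /-- damping (droop) coefficient -/
  E : V → ℝ
  E_pos : ∀ i, 0 < E i
  /-- line susceptance -/
  b : G.edgeSet → ℝ
  b_pos : ∀ e, 0 < b e
  /-- buses with a control input -/
  Iu : Finset V
  /-- buses with a transient frequency requirement -/
  Iω : Finset V
  Iω_subset : Iω ⊆ Iu
  /-- time constant of the low-pass filter -/
  τ : V → ℝ
  τ_pos : ∀ i ∈ Iu, 0 < τ i
  /-- lower safe frequency bound -/
  ωlo : V → ℝ
  /-- upper safe frequency bound -/
  ωhi : V → ℝ
  ωlo_lt_ωhi : ∀ i ∈ Iω, ωlo i < ωhi i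
  /-- sensitivity parameter bounding the control input -/
  ε : V → ℝ
  ε_pos : ∀ i ∈ Iu, 0 < ε i
  /-- control cost -/
  c : V → ℝ
  c_pos : ∀ i, 0 < c i
  /-- penalty on the violation of the frequency bounds -/
  d : V → ℝ
  d_pos : ∀ i ∈ Iω, 0 < d i

namespace PowerNetwork

variable {V : Type*} [Fintype V] [DecidableEq V] {G : SimpleGraph V}

/-- Coordinates of a state `x = (λ, ω, α_BL)`: lines, buses, buses. -/
abbrev StateIdx (G : SimpleGraph V) := G.edgeSet ⊕ V ⊕ V

variable [DecidableRel G.Adj]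

/-- The incidence matrix. -/
def incidence (P : PowerNetwork G) : Matrix G.edgeSet V ℝ :=
  Matrix.of fun e i => if i = P.posEnd e then 1 else if i = P.negEnd e then -1 else 0

/-- The diagonal of `G̃`: the coefficient of the time derivative of each state in the linearized
model (`0` for the algebraic equation `α_BL,i = 0` at an uncontrolled bus). -/
def inertiaDiag (P : PowerNetwork G) : StateIdx G → ℝ :=
  Sum.elim (fun _ => 1) (Sum.elim P.M (fun i => if i ∈ P.Iu then P.M i else 0))

/-- `G̃` in the linearized model `G̃ ẋ = Ã x + B̃₁ p + B̃₂ u`. -/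
def Gt (P : PowerNetwork G) : Matrix (StateIdx G) (StateIdx G) ℝ :=
  Matrix.diagonal P.inertiaDiag

/-- `Ã` in the linearized model, whose equations are
* `λ̇ = D ω`,
* `M ω̇ = -E ω - Dᵀ Y_b λ + p + α_BL`,
* `M_i α̇_i = -(1/τ_i) α_i - ω_i + u_i` at controlled buses,
* `0 = -α_i + u_i` at uncontrolled buses (where moreover `u_i = 0` is imposed). -/
def At (P : PowerNetwork G) : Matrix (StateIdx G) (StateIdx G) ℝ :=
  Matrix.fromBlocks
    0
    (Matrix.fromCols P.incidence 0)
    (Matrix.fromRows (-(P.incidenceᵀ * Matrix.diagonal P.b)) 0)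
    (Matrix.fromBlocks
      (-Matrix.diagonal P.E)
      1
      (-Matrix.diagonal fun i => if i ∈ P.Iu then 1 else 0)
      (-Matrix.diagonal fun i => if i ∈ P.Iu then 1 / P.τ i else 1))

/-- `B̃₁` in the linearized model: the power injection enters the frequency equations. -/
def Bt₁ (_P : PowerNetwork G) : Matrix (StateIdx G) V ℝ :=
  Matrix.fromRows 0 (Matrix.fromRows 1 0)

/-- `B̃₂` in the linearized model: the input enters the filter equations. -/
def Bt₂ (_P : PowerNetwork G) : Matrix (StateIdx G) V ℝ :=
  Matrix.fromRows 0 (Matrix.fromRows 0 1)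

end PowerNetwork

/-- The remaining data of one instance of the optimization problem with prediction horizon
`N = L + 1`. The prediction times `1, …, N` are indexed by `Fin (L + 1)`, starting from `0`. -/
structure MPCData {V : Type*} [Fintype V] [DecidableEq V] {G : SimpleGraph V}
    [DecidableRel G.Adj] (P : PowerNetwork G) (L : ℕ) where
  /-- discretization step -/
  T : ℝ
  T_pos : 0 < T
  /-- the matrix `A` of the backward Euler discretization -/
  A : Matrix (PowerNetwork.StateIdx G) (PowerNetwork.StateIdx G) ℝ
  /-- `A = G̃` is the backward Euler matrix of the descriptor model, `A = I` its normalized form -/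
  A_eq : A = P.Gt ∨ A = 1
  /-- forecasted power injection -/
  pf : Fin (L + 1) → V → ℝ
  /-- sampled state `x(t^w)` -/
  x₀ : PowerNetwork.StateIdx G → ℝ

namespace MPCData

variable {V : Type*} [Fintype V] [DecidableEq V] {G : SimpleGraph V}
  [DecidableRel G.Adj] {P : PowerNetwork G} {L : ℕ}

open PowerNetwork

/-- `F = G̃ - T Ã`. -/
def F (Q : MPCData P L) : Matrix (StateIdx G) (StateIdx G) ℝ := P.Gt - Q.T • P.At

/-- `B₁ = T B̃₁`. -/
def B₁ (Q : MPCData P L) : Matrix (StateIdx G) V ℝ := Q.T • P.Bt₁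

/-- `B₂ = T B̃₂`. -/
def B₂ (Q : MPCData P L) : Matrix (StateIdx G) V ℝ := Q.T • P.Bt₂

/-- Coordinates of the decision variable `Y = (X̂, û, S)`. -/
abbrev PrimalIdx (P : PowerNetwork G) (L : ℕ) :=
  (Fin (L + 1) × StateIdx G) ⊕ V ⊕ (Fin (L + 1) × {i // i ∈ P.Iω})

/-- Inequality constraints; `true` marks the upper and `false` the lower bound. -/
abbrev IneqIdx (P : PowerNetwork G) (L : ℕ) :=
  (Fin (L + 1) × {i // i ∈ P.Iω} × Bool) ⊕ ({i // i ∈ P.Iu} × Bool)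

/-- Equality constraints: prediction model, initial condition, location of the inputs. -/
abbrev EqIdx (P : PowerNetwork G) (L : ℕ) :=
  (Fin L × StateIdx G) ⊕ StateIdx G ⊕ {i // i ∉ P.Iu}

abbrev Primal (P : PowerNetwork G) (L : ℕ) := EuclideanSpace ℝ (PrimalIdx P L)

abbrev IneqDual (P : PowerNetwork G) (L : ℕ) := EuclideanSpace ℝ (IneqIdx P L)

abbrev EqDual (P : PowerNetwork G) (L : ℕ) := EuclideanSpace ℝ (EqIdx P L)

/-- The predicted state `x̂(k)`. -/
def state (Y : Primal P L) (k : Fin (L + 1)) : StateIdx G → ℝ := fun j => Y (Sum.inl (k, j))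

/-- The predicted frequency `ω̂_i(k)`. -/
def freq (Y : Primal P L) (k : Fin (L + 1)) (i : V) : ℝ := state Y k (Sum.inr (Sum.inl i))

/-- The predicted filter state `α̂_BL,i(k)`. -/
def filt (Y : Primal P L) (k : Fin (L + 1)) (i : V) : ℝ := state Y k (Sum.inr (Sum.inr i))

/-- The input `û`. -/
def input (Y : Primal P L) : V → ℝ := fun i => Y (Sum.inr (Sum.inl i))

/-- The relaxation variable `s_i(k)`. -/
def slack (Y : Primal P L) (k : Fin (L + 1)) (i : {i // i ∈ P.Iω}) : ℝ :=
  Y (Sum.inr (Sum.inr (k, i)))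

/-- The sampled filter state `α_BL,i(t^w)`. -/
def filt₀ (Q : MPCData P L) (i : V) : ℝ := Q.x₀ (Sum.inr (Sum.inr i))

/-- `F x̂(k+1) - A x̂(k) - B₁ p̂(k) - B₂ û`. -/
def modelResidual (Q : MPCData P L) (Y : Primal P L) (k : Fin L) : StateIdx G → ℝ :=
  Q.F *ᵥ state Y k.succ - Q.A *ᵥ state Y k.castSucc - Q.B₁ *ᵥ Q.pf k.castSucc
    - Q.B₂ *ᵥ input Y

/-- The augmented objective function `g^aug`. -/
def gAug (Q : MPCData P L) (Y : Primal P L) : ℝ :=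
  (∑ k : Fin L, ∑ j, Q.modelResidual Y k j ^ 2)
    + (∑ k : Fin (L + 1),
        ((∑ i, P.c i * filt Y k i ^ 2)
          + ∑ i : {i // i ∈ P.Iω}, P.d i * slack Y k i ^ 2))
    + ∑ j, (state Y 0 j - Q.x₀ j) ^ 2

/-- Feasibility for the optimization problem. -/
structure Feasible (Q : MPCData P L) (Y : Primal P L) : Prop where
  model : ∀ k : Fin L, Q.F *ᵥ state Y k.succ
    = Q.A *ᵥ state Y k.castSucc + Q.B₁ *ᵥ Q.pf k.castSucc + Q.B₂ *ᵥ input Y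
  location : ∀ i ∉ P.Iu, input Y i = 0
  init : state Y 0 = Q.x₀
  lower : ∀ (k : Fin (L + 1)) (i : {i // i ∈ P.Iω}), P.ωlo i - slack Y k i ≤ freq Y k i
  upper : ∀ (k : Fin (L + 1)) (i : {i // i ∈ P.Iω}), freq Y k i ≤ P.ωhi i + slack Y k i
  sens : ∀ i ∈ P.Iu, |input Y i| ≤ P.ε i * |Q.filt₀ i|

/-- Optimal solutions of the problem `R^aug`: minimize `g^aug` over the feasible set. -/
def IsOptimal (Q : MPCData P L) (Y : Primal P L) : Prop :=
  Q.Feasible Y ∧ ∀ Y', Q.Feasible Y' → Q.gAug Y ≤ Q.gAug Y'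

/-- The affine map `Y ↦ R₁ Y - r₁` of the inequality constraints. -/
def ineqMap (Q : MPCData P L) (Y : Primal P L) : IneqIdx P L → ℝ
  | Sum.inl (k, i, true) => freq Y k i - slack Y k i - P.ωhi i
  | Sum.inl (k, i, false) => P.ωlo i - slack Y k i - freq Y k i
  | Sum.inr (i, true) => input Y i - P.ε i * |Q.filt₀ i|
  | Sum.inr (i, false) => -input Y i - P.ε i * |Q.filt₀ i|

/-- The affine map `Y ↦ R₂ Y - r₂` of the equality constraints. -/
def eqMap (Q : MPCData P L) (Y : Primal P L) : EqIdx P L → ℝ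
  | Sum.inl (k, j) => Q.modelResidual Y k j
  | Sum.inr (Sum.inl j) => state Y 0 j - Q.x₀ j
  | Sum.inr (Sum.inr i) => input Y i

/-- The Lagrangian `g^aug(Y) + ηᵀ (R₁ Y - r₁) + μᵀ (R₂ Y - r₂)`. -/
def lagrangian (Q : MPCData P L) (Y : Primal P L) (η : IneqDual P L) (μ : EqDual P L) : ℝ :=
  Q.gAug Y + ∑ i, η i * Q.ineqMap Y i + ∑ i, μ i * Q.eqMap Y i

/-- Primal and dual variables `(Z, η, μ)`. -/
abbrev PD (P : PowerNetwork G) (L : ℕ) := Primal P L × IneqDual P L × EqDual P L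

/-- Saddle points of the Lagrangian over `{η ≥ 0}`, that is, primal-dual solutions. -/
def IsSaddle (Q : MPCData P L) (x : PD P L) : Prop :=
  (∀ i, 0 ≤ x.2.1 i) ∧
    (∀ (η : IneqDual P L) (μ : EqDual P L), (∀ i, 0 ≤ η i) →
      Q.lagrangian x.1 η μ ≤ Q.lagrangian x.1 x.2.1 x.2.2) ∧
    ∀ Y, Q.lagrangian x.1 x.2.1 x.2.2 ≤ Q.lagrangian Y x.2.1 x.2.2

/-- `[a]⁺_b`. -/
def posProj (a b : ℝ) : ℝ := if 0 < b then a else max a 0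

/-- Right-hand side of the primal dynamics: `-∇_Z 𝔏(Z, η, μ)`. -/
def primalField (Q : MPCData P L) (x : PD P L) (i : PrimalIdx P L) : ℝ :=
  -(gradient (fun Z => Q.lagrangian Z x.2.1 x.2.2) x.1) i

/-- Right-hand side of the projected dynamics of `η`: `[R₁ Z - r₁]⁺_η`. -/
def ineqField (Q : MPCData P L) (x : PD P L) (i : IneqIdx P L) : ℝ :=
  posProj (Q.ineqMap x.1 i) (x.2.1 i)

/-- Right-hand side of the dynamics of `μ`: `R₂ Z - r₂`. -/
def eqField (Q : MPCData P L) (x : PD P L) (i : EqIdx P L) : ℝ := Q.eqMap x.1 i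

/-- Absolute continuity on every compact interval `[0, t]`. -/
def LocallyAC (f : ℝ → ℝ) : Prop := ∀ t, 0 ≤ t → AbsolutelyContinuousOnInterval f 0 t

/-- Carathéodory solutions on `[0, ∞)` of the saddle-point dynamics: every coordinate is locally
absolutely continuous and satisfies its differential equation at almost every time. The initial
multiplier of the inequality constraints is nonnegative. -/
structure IsTrajectory (Q : MPCData P L) (εZ εη εμ : ℝ) (x : ℝ → PD P L) : Prop where
  init : ∀ i, 0 ≤ (x 0).2.1 i
  ac_primal : ∀ i, LocallyAC fun t => (x t).1 i
  ac_ineq : ∀ i, LocallyAC fun t => (x t).2.1 i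
  ac_eq : ∀ i, LocallyAC fun t => (x t).2.2 i
  ode_primal : ∀ i, ∀ᵐ t ∂(MeasureTheory.volume.restrict (Set.Ioi (0 : ℝ))),
    HasDerivAt (fun s => (x s).1 i) (εZ⁻¹ * Q.primalField (x t) i) t
  ode_ineq : ∀ i, ∀ᵐ t ∂(MeasureTheory.volume.restrict (Set.Ioi (0 : ℝ))),
    HasDerivAt (fun s => (x s).2.1 i) (εη⁻¹ * Q.ineqField (x t) i) t
  ode_eq : ∀ i, ∀ᵐ t ∂(MeasureTheory.volume.restrict (Set.Ioi (0 : ℝ))),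
    HasDerivAt (fun s => (x s).2.2 i) (εμ⁻¹ * Q.eqField (x t) i) t

/-- The agents are the buses and the lines; a bus and a line communicate directly exactly when
they are incident. -/
def agentGraph (G : SimpleGraph V) : SimpleGraph (V ⊕ G.edgeSet) :=
  SimpleGraph.fromRel fun a c =>
    match a, c with
    | Sum.inl i, Sum.inr e => i ∈ (e : Sym2 V)
    | _, _ => False

/-- The agent that holds a coordinate of the state. -/
def stateOwner : StateIdx G → V ⊕ G.edgeSet
  | Sum.inl e => Sum.inr e
  | Sum.inr (Sum.inl i) => Sum.inl i
  | Sum.inr (Sum.inr i) => Sum.inl i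

/-- The agent that holds a primal variable. -/
def primalOwner : PrimalIdx P L → V ⊕ G.edgeSet
  | Sum.inl (_, j) => stateOwner j
  | Sum.inr (Sum.inl i) => Sum.inl i
  | Sum.inr (Sum.inr (_, i)) => Sum.inl i

/-- The agent that holds the multiplier of an inequality constraint. -/
def ineqOwner : IneqIdx P L → V ⊕ G.edgeSet
  | Sum.inl (_, i, _) => Sum.inl i
  | Sum.inr (i, _) => Sum.inl i

/-- The agent that holds the multiplier of an equality constraint. -/
def eqOwner : EqIdx P L → V ⊕ G.edgeSet
  | Sum.inl (_, j) => stateOwner j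
  | Sum.inr (Sum.inl j) => stateOwner j
  | Sum.inr (Sum.inr i) => Sum.inl i

/-- `x` and `y` agree in all variables held by agents within `r` hops of the agent `a`. -/
def AgreeWithin (r : ℕ∞) (a : V ⊕ G.edgeSet) (x y : PD P L) : Prop :=
  (∀ i, (agentGraph G).edist a (primalOwner i) ≤ r → x.1 i = y.1 i) ∧
    (∀ i, (agentGraph G).edist a (ineqOwner i) ≤ r → x.2.1 i = y.2.1 i) ∧
    ∀ i, (agentGraph G).edist a (eqOwner i) ≤ r → x.2.2 i = y.2.2 i

end MPCData

end

/-! The objective is a sum of squares of affine functions, so the problem is a linear least squares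
program, `obj Y = ‖B Y - r‖²`, with affine constraints. Everything about the primal problem rests on
injectivity of `B` (`program_B_injective`), although neither the input nor the line states and
frequencies beyond the first time are penalized directly. If all linearized residuals and costs
vanish, the first prediction step reads `F x = B₂ u` with zero filter state. Pairing the swing
equations with the frequency is an energy balance in which damping and line energy are nonnegative;
hence frequency and line state vanish, the filter rows then give `u = 0`, and invertibility of `F`
propagates zero along the horizon. In finite dimension injectivity yields strong convexity and
coercivity. Feasibility holds because `F` is surjective and the slacks absorb any violation, and
Farkas' lemma supplies multipliers without a constraint qualification.

The multiplier dynamics are discontinuous, so existence is obtained by Skorokhod reflection. A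
reflected path is an unreflected path `w` plus the running maximum of the negative part of `w`.
Reflection is Lipschitz in the sup norm, so the integral equation for `w` is solved on the whole
half-line by a contraction in an exponentially weighted norm. The reflected path solves the
projected equation wherever the running maximum is differentiable, thus almost everywhere.

For convergence, the squared distance to any KKT point, weighted by the time scales, decreases at
least at the rate `2 (2 ‖B (Z - Y*)‖² + slackness)`, where both summands are nonnegative
(`KKT.dissipation`, `flow_dissipation`). This gives Lyapunov stability and boundedness. Barbalat's
lemma makes the rate tend to zero, hence `Z → Y*`; a second application makes the primal velocity
tend to zero. A cluster point of the trajectory is therefore stationary and complementary, that is,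
a KKT point. Since the distance to this point does not increase either, the whole trajectory
converges to it.

For locality, the Lagrangian is a sum of terms, each owned by an agent and involving only primal
variables at distance at most one. Differentiating in one coordinate keeps only the terms owned
within one hop, whose variables lie within two hops. -/

open Filter Topology MeasureTheory Set
open scoped NNReal

/-! ### Absolutely continuous functions and Barbalat's lemma -/

/-- The fundamental theorem of calculus, as an inequality, for an absolutely continuous function
whose derivative is bounded above almost everywhere by a continuous function. -/
theorem AbsolutelyContinuousOnInterval.sub_le_integral {f φ : ℝ → ℝ} {a b : ℝ} (hab : a ≤ b)
    (hf : AbsolutelyContinuousOnInterval f a b) (hφ : ContinuousOn φ (Icc a b))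
    (h : ∀ᵐ t ∂(volume.restrict (Ioo a b)), ∃ f', HasDerivAt f f' t ∧ f' ≤ φ t) :
    f b - f a ≤ ∫ t in a..b, φ t := by
  rw [← hf.integral_deriv_eq_sub]
  refine intervalIntegral.integral_mono_ae_restrict hab hf.intervalIntegrable_deriv
    (hφ.intervalIntegrable_of_Icc hab) ?_
  rw [← Measure.restrict_congr_set Ioo_ae_eq_Icc]
  filter_upwards [h] with t ⟨f', h1, h2⟩
  rwa [h1.deriv]

/-- An absolutely continuous function whose derivative agrees almost everywhere with a continuous
function is an integral of the latter. -/
theorem AbsolutelyContinuousOnInterval.sub_eq_integral {f φ : ℝ → ℝ} {a b : ℝ} (hab : a ≤ b)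
    (hf : AbsolutelyContinuousOnInterval f a b)
    (h : ∀ᵐ t ∂(volume.restrict (Ioo a b)), HasDerivAt f (φ t) t) :
    f b - f a = ∫ t in a..b, φ t := by
  rw [← hf.integral_deriv_eq_sub, intervalIntegral.integral_of_le hab,
    intervalIntegral.integral_of_le hab, integral_Ioc_eq_integral_Ioo, integral_Ioc_eq_integral_Ioo]
  refine integral_congr_ae ?_
  filter_upwards [h] with t h1 using h1.deriv

theorem ae_restrict_Ioo_of_Ioi {p : ℝ → Prop} {a b : ℝ} (ha : 0 ≤ a)
    (h : ∀ᵐ t ∂(volume.restrict (Ioi (0 : ℝ))), p t) : ∀ᵐ t ∂(volume.restrict (Ioo a b)), p t :=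
  ae_restrict_of_ae_restrict_of_subset (fun _ ht => ha.trans_lt ht.1) h

/-- Barbalat's lemma. -/
theorem tendsto_zero_of_uniformContinuousOn_deriv {f φ : ℝ → ℝ} {l : ℝ}
    (hf : Tendsto f atTop (𝓝 l)) (hd : ∀ t, 0 < t → HasDerivAt f (φ t) t)
    (hφ : UniformContinuousOn φ (Ici 0)) : Tendsto φ atTop (𝓝 0) := by
  rw [Metric.tendsto_atTop]
  intro ε hε
  obtain ⟨δ, hδ, hδ'⟩ := Metric.uniformContinuousOn_iff.1 hφ (ε / 2) (half_pos hε)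
  -- On a window of length `δ / 2` a slope of size `ε / 2` would change `f` by `ε * δ / 4`, whereas
  -- two values in the tail differ by less than `2 * (ε * δ / 16)`.
  obtain ⟨N, hN⟩ := Metric.tendsto_atTop.1 hf (ε * δ / 16) (by positivity)
  refine ⟨max N 1, fun t ht => ?_⟩
  have htN : N ≤ t := (le_max_left _ _).trans ht
  have ht1 : 1 ≤ t := (le_max_right _ _).trans ht
  obtain ⟨c, hc, hc'⟩ := exists_hasDerivAt_eq_slope f φ (show t < t + δ / 2 by linarith)
    (fun s hs => (hd s (by linarith [hs.1])).continuousAt.continuousWithinAt)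
    (fun s hs => hd s (by linarith [hs.1]))
  have h1 := hN t htN
  have h2 := hN (t + δ / 2) (by linarith)
  have h3 := hδ' t (by simp; linarith) c (by simp; linarith [hc.1])
    (by rw [Real.dist_eq, abs_lt]; constructor <;> linarith [hc.1, hc.2])
  rw [Real.dist_eq, abs_lt] at h1 h2 h3
  have h4 : φ c * (δ / 2) = f (t + δ / 2) - f t := by
    rw [hc', add_sub_cancel_left, div_mul_cancel₀ _ (half_pos hδ).ne']
  rw [Real.dist_eq, sub_zero, abs_lt]
  have h5 : φ c < ε / 2 := by
    by_contra! hcon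
    nlinarith [mul_le_mul_of_nonneg_right hcon (half_pos hδ).le]
  have h6 : -(ε / 2) < φ c := by
    by_contra! hcon
    nlinarith [mul_le_mul_of_nonneg_right hcon (half_pos hδ).le]
  constructor <;> linarith

/-! ### Skorokhod reflection of a scalar path -/

/-- The running maximum `sup_{0 ≤ s ≤ t} max 0 (-w s)`, which is the regulator of the Skorokhod
reflection of `w` at zero. -/
noncomputable def skorokhodReg (w : ℝ → ℝ) (t : ℝ) : ℝ :=
  sSup ((fun θ : ℝ => max 0 (-w (θ * t))) '' Icc 0 1)

namespace skorokhodReg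

variable {w v : ℝ → ℝ} {s t : ℝ}

theorem le (hw : Continuous w) (hs : 0 ≤ s) (hst : s ≤ t) :
    max 0 (-w s) ≤ skorokhodReg w t := by
  refine le_csSup ?_ ?_
  · exact (isCompact_Icc.image (by fun_prop)).bddAbove
  · rcases hs.eq_or_lt with rfl | hs
    · exact ⟨0, by simp, by simp⟩
    · refine ⟨s / t, ⟨div_nonneg hs.le (hs.le.trans hst),
        div_le_one_of_le₀ hst (hs.le.trans hst)⟩, ?_⟩
      have : t ≠ 0 := by linarith
      simp only [div_mul_cancel₀ s this]

theorem le_of_forall (ht : 0 ≤ t) {c : ℝ} (h : ∀ s, 0 ≤ s → s ≤ t → max 0 (-w s) ≤ c) :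
    skorokhodReg w t ≤ c := by
  refine csSup_le ((nonempty_Icc.2 zero_le_one).image _) ?_
  rintro _ ⟨θ, ⟨h0, h1⟩, rfl⟩
  exact h _ (mul_nonneg h0 ht) (mul_le_of_le_one_left ht h1)

/-- Rescaling time to `θ ∈ [0, 1]` in the definition keeps the supremum over a fixed compact set, so
continuity in `t` is that of a parametric supremum. -/
theorem continuous (hw : Continuous w) : Continuous (skorokhodReg w) :=
  isCompact_Icc.continuous_sSup (f := fun t θ : ℝ => max 0 (-w (θ * t)))
    (show Continuous fun p : ℝ × ℝ => max 0 (-w (p.2 * p.1)) by fun_prop)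

theorem nonneg (hw : Continuous w) (ht : 0 ≤ t) : 0 ≤ skorokhodReg w t :=
  (le_max_left _ _).trans (le hw le_rfl ht)

theorem neg_le (hw : Continuous w) (ht : 0 ≤ t) : -w t ≤ skorokhodReg w t :=
  (le_max_right _ _).trans (le hw ht le_rfl)

theorem mono (hw : Continuous w) (hs : 0 ≤ s) (hst : s ≤ t) :
    skorokhodReg w s ≤ skorokhodReg w t :=
  le_of_forall hs fun _ hr hrs => le hw hr (hrs.trans hst)

theorem zero (h0 : 0 ≤ w 0) : skorokhodReg w 0 = 0 := by
  simp [skorokhodReg, h0]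

/-- The running maximum grows after `s` only as far as the path drops below its value at `s`. This
transfers Lipschitz bounds from the path to the regulator. -/
theorem le_add (hw : Continuous w) (hs : 0 ≤ s) (hst : s ≤ t) {c : ℝ} (hc : 0 ≤ c)
    (h : ∀ r, s ≤ r → r ≤ t → w s - c ≤ w r) : skorokhodReg w t ≤ skorokhodReg w s + c := by
  refine le_of_forall (hs.trans hst) fun r hr hrt => ?_
  rcases le_total r s with hrs | hrs
  · linarith [le hw hr hrs]
  · refine max_le (by linarith [nonneg hw hs]) ?_
    linarith [neg_le hw hs, h r hrs hrt]

/-- A supremum is 1-Lipschitz in the sup norm of the function; this is the estimate behind the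
contraction below. -/
theorem abs_sub_le (hw : Continuous w) (hv : Continuous v) (ht : 0 ≤ t) {c : ℝ}
    (h : ∀ r, 0 ≤ r → r ≤ t → |w r - v r| ≤ c) :
    |skorokhodReg w t - skorokhodReg v t| ≤ c := by
  have key : ∀ w v : ℝ → ℝ, Continuous w → Continuous v →
      (∀ r, 0 ≤ r → r ≤ t → |w r - v r| ≤ c) → skorokhodReg w t ≤ skorokhodReg v t + c := by
    intro w v hw hv h
    refine le_of_forall ht fun r hr hrt => max_le ?_ ?_
    · linarith [nonneg hv ht, (abs_nonneg _).trans (h 0 le_rfl ht)]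
    · linarith [(abs_le.1 (h r hr hrt)).1, (le_max_right _ _).trans (le hv hr hrt)]
  rw [_root_.abs_sub_le_iff]
  constructor
  · linarith [key w v hw hv h]
  · linarith [key v w hv hw fun r hr hrt => by rw [abs_sub_comm]; exact h r hr hrt]

/-- The regulator is locally constant where the reflected path is positive. -/
theorem eventually_eq (hw : Continuous w) (ht : 0 < t) (hpos : 0 < w t + skorokhodReg w t) :
    ∀ᶠ s in 𝓝 t, skorokhodReg w s = skorokhodReg w t := by
  -- The level `c` separates `-w` from the regulator throughout a neighborhood of `t`, so the
  -- running maximum cannot be renewed there.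
  obtain ⟨c, hc1, hc2⟩ := exists_between (show -w t < skorokhodReg w t by linarith)
  have h1 : ∀ᶠ s in 𝓝 t, -w s < c ∧ c < skorokhodReg w s ∧ 0 < s :=
    (hw.neg.continuousAt.eventually_lt_const hc1).and
      (((continuous hw).continuousAt.eventually_const_lt hc2).and (lt_mem_nhds ht))
  obtain ⟨δ, hδ, hball⟩ := Metric.eventually_nhds_iff_ball.1 h1
  have key : ∀ s r, s ∈ Metric.ball t δ → r ∈ Metric.ball t δ → s ≤ r →
      skorokhodReg w r = skorokhodReg w s := by
    intro s r hs hr hsr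
    have hs0 := (hball s hs).2.2.le
    refine le_antisymm (le_of_forall (hs0.trans hsr) fun q hq hqr => ?_) (mono hw hs0 hsr)
    rcases le_total q s with hqs | hqs
    · exact le hw hq hqs
    · refine max_le (nonneg hw hs0) ?_
      have : q ∈ Metric.ball t δ := by
        rw [Real.ball_eq_Ioo] at *
        exact ⟨by linarith [hs.1], by linarith [hr.2]⟩
      linarith [(hball q this).1, (hball s hs).2.1]
  filter_upwards [Metric.ball_mem_nhds t hδ] with s hs
  rcases le_total s t with h | h
  · exact (key s t hs (Metric.mem_ball_self hδ) h).symm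
  · exact key t s (Metric.mem_ball_self hδ) hs h

/-- At a point of differentiability, the reflected path solves the projected equation. -/
theorem hasDerivAt_add {a : ℝ} (hw : Continuous w) (ht : 0 < t) (hd : HasDerivAt w a t)
    (hm : DifferentiableAt ℝ (skorokhodReg w) t) :
    HasDerivAt (fun s => w s + skorokhodReg w s)
      (MPCData.posProj a (w t + skorokhodReg w t)) t := by
  rcases (show 0 ≤ w t + skorokhodReg w t by linarith [neg_le hw ht.le]).eq_or_lt with h0 | hpos
  · have hd' := hd.add hm.hasDerivAt
    -- At a contact time the nonnegative reflected path has a minimum, so `a` plus the derivative of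
    -- the monotone regulator is zero. Hence `a ≤ 0` and the projected velocity is also zero.
    have hmin : IsLocalMin (fun s => w s + skorokhodReg w s) t := by
      filter_upwards [lt_mem_nhds ht] with s hs
      linarith [neg_le hw hs.le]
    have hz := hmin.hasDerivAt_eq_zero hd'
    have hm0 : 0 ≤ deriv (skorokhodReg w) t := by
      rw [← derivWithin_of_mem_nhds (Ioi_mem_nhds ht)]
      exact MonotoneOn.derivWithin_nonneg fun x hx y _ hxy => mono hw (le_of_lt hx) hxy
    rw [MPCData.posProj, ← h0, if_neg (lt_irrefl 0), max_eq_right (by linarith), ← hz]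
    exact hd'
  · rw [MPCData.posProj, if_pos hpos]
    have : HasDerivAt (skorokhodReg w) 0 t :=
      (hasDerivAt_const t (skorokhodReg w t)).congr_of_eventuallyEq (eventually_eq hw ht hpos)
    have h := hd.add this
    rwa [add_zero] at h

end skorokhodReg

/-! ### Global existence for projected dynamics -/

section ProjectedDynamics

variable {J : Type*} [Fintype J]

open Classical in
/-- The vector field `f`, projected so that the coordinates in `C` stay nonnegative. -/
noncomputable def projField (C : Set J) (f : (J → ℝ) → J → ℝ) (x : J → ℝ) (j : J) : ℝ :=
  if j ∈ C then MPCData.posProj (f x j) (x j) else f x j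

/-- Carathéodory solutions on `[0, ∞)` of the projected dynamics of `f` on the orthant
`{x | ∀ j ∈ C, 0 ≤ x j}`. -/
structure IsProjTrajectory (C : Set J) (f : (J → ℝ) → J → ℝ) (x : ℝ → J → ℝ) : Prop where
  init : ∀ j ∈ C, 0 ≤ x 0 j
  ac : ∀ j, MPCData.LocallyAC fun t => x t j
  ode : ∀ j, ∀ᵐ t ∂(volume.restrict (Ioi (0 : ℝ))),
    HasDerivAt (fun s => x s j) (projField C f (x t) j) t

open Classical in
/-- The Skorokhod reflection of a path in the coordinates belonging to `C`. -/
noncomputable def reflectPath (C : Set J) (w : ℝ → J → ℝ) (t : ℝ) (j : J) : ℝ :=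
  w t j + if j ∈ C then skorokhodReg (fun s => w s j) t else 0

omit [Fintype J] in
theorem continuous_reflectPath (C : Set J) {w : ℝ → J → ℝ} (hw : Continuous w) :
    Continuous (reflectPath C w) := by
  refine continuous_pi fun j => ?_
  unfold reflectPath
  have hj : Continuous fun s => w s j := (continuous_apply j).comp hw
  by_cases h : j ∈ C
  · simp only [h, if_true]
    exact hj.add (skorokhodReg.continuous hj)
  · simpa only [h, if_false, add_zero] using hj

/-- The factor 2 counts one deviation for the path and one for its regulator. -/
theorem norm_reflectPath_sub_le (C : Set J) {w v : ℝ → J → ℝ} (hw : Continuous w)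
    (hv : Continuous v) {t c : ℝ} (ht : 0 ≤ t) (h : ∀ r, 0 ≤ r → r ≤ t → ‖w r - v r‖ ≤ c) :
    ‖reflectPath C w t - reflectPath C v t‖ ≤ 2 * c := by
  have hc : 0 ≤ c := (norm_nonneg _).trans (h 0 le_rfl ht)
  refine (pi_norm_le_iff_of_nonneg (by positivity)).2 fun j => ?_
  have hj : ∀ r, 0 ≤ r → r ≤ t → |w r j - v r j| ≤ c := fun r hr hrt =>
    (norm_le_pi_norm (w r - v r) j).trans (h r hr hrt)
  have h1 := abs_le.1 (hj t ht le_rfl)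
  simp only [Pi.sub_apply, reflectPath, Real.norm_eq_abs]
  by_cases hC : j ∈ C
  · have h2 := abs_le.1 (skorokhodReg.abs_sub_le (t := t) ((continuous_apply j).comp hw)
      ((continuous_apply j).comp hv) ht hj)
    simp only [Function.comp_def] at h2
    simp only [hC, if_true]
    rw [abs_le]; constructor <;> linarith [h1.1, h1.2, h2.1, h2.2]
  · simp only [hC, if_false]
    rw [abs_le]; constructor <;> linarith [h1.1, h1.2]

omit [Fintype J] in
theorem reflectPath_const_zero (C : Set J) (t : ℝ) :
    reflectPath C (fun _ => (0 : J → ℝ)) t = 0 := by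
  ext j
  simp [reflectPath, skorokhodReg]

/-- Integration gains a factor `1 / κ` on functions of growth `exp (κ s)`; a large `κ` thus turns
the Picard operator into a contraction without restricting the time interval. -/
theorem norm_integral_le_exp {h : ℝ → J → ℝ} {c κ t : ℝ} (hκ : 0 < κ) (hc : 0 ≤ c) (ht : 0 ≤ t)
    (hb : ∀ s, 0 ≤ s → s ≤ t → ‖h s‖ ≤ c * Real.exp (κ * s)) :
    ‖∫ s in (0 : ℝ)..t, h s‖ ≤ c / κ * Real.exp (κ * t) := by
  have h1 : ‖∫ s in (0 : ℝ)..t, h s‖ ≤ ∫ s in (0 : ℝ)..t, c * Real.exp (κ * s) :=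
    intervalIntegral.norm_integral_le_of_norm_le ht
      (Eventually.of_forall fun s hs => hb s hs.1.le hs.2)
      ((by fun_prop : Continuous fun s => c * Real.exp (κ * s)).intervalIntegrable _ _)
  have h2 : ∫ s in (0 : ℝ)..t, c * Real.exp (κ * s)
      = c / κ * Real.exp (κ * t) - c / κ * Real.exp (κ * 0) := by
    refine intervalIntegral.integral_eq_sub_of_hasDerivAt (f := fun s => c / κ * Real.exp (κ * s))
      (fun s _ => ?_)
      ((by fun_prop : Continuous fun s => c * Real.exp (κ * s)).intervalIntegrable _ _)
    exact (((hasDerivAt_id' s).const_mul κ).exp.const_mul (c / κ)).congr_deriv (by field_simp)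
  have h3 : 0 ≤ c / κ * Real.exp (κ * 0) := by positivity
  linarith

/-- The integral equation whose solutions, after reflection, solve the projected dynamics. -/
theorem exists_reflected_integral_equation (C : Set J) {f : (J → ℝ) → J → ℝ} {K : ℝ≥0}
    (hf : LipschitzWith K f) (x₀ : J → ℝ) :
    ∃ w : ℝ → J → ℝ, Continuous w ∧
      ∀ t, 0 ≤ t → w t = x₀ + ∫ s in (0 : ℝ)..t, f (reflectPath C w s) := by
  -- The Picard operator below has Lipschitz constant at most `2 * K / κ`, with the 2 coming from
  -- reflection. Hence `4 * K` suffices for a contraction by `1 / 2`, and the added 1 keeps `κ`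
  -- positive when `K = 0`.
  set κ : ℝ := 4 * K + 1 with hκdef
  have hκ : 0 < κ := by positivity
  -- weighted paths
  let P : BoundedContinuousFunction ℝ (J → ℝ) → ℝ → J → ℝ :=
    fun v t => Real.exp (κ * max t 0) • v t
  have hP : ∀ v, Continuous (P v) := fun v =>
    (by fun_prop : Continuous fun t : ℝ => Real.exp (κ * max t 0)).smul v.continuous
  have hexp : ∀ {r s : ℝ}, 0 ≤ r → r ≤ s → Real.exp (κ * max r 0) ≤ Real.exp (κ * s) := by
    intro r s hr hrs
    rw [max_eq_left hr]
    exact Real.exp_le_exp.2 (by gcongr)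
  have hPsub : ∀ u v (s : ℝ), 0 ≤ s →
      ‖reflectPath C (P u) s - reflectPath C (P v) s‖ ≤ 2 * (Real.exp (κ * s) * dist u v) := by
    intro u v s hs
    refine norm_reflectPath_sub_le C (hP u) (hP v) hs fun r hr hrs => ?_
    simp only [P]
    rw [← smul_sub, norm_smul, Real.norm_eq_abs, abs_of_pos (Real.exp_pos _), ← dist_eq_norm]
    refine mul_le_mul (hexp hr hrs) ?_ dist_nonneg (Real.exp_pos _).le
    · exact BoundedContinuousFunction.dist_coe_le_dist r
  have hP0 : ∀ s, reflectPath C (P 0) s = 0 := by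
    intro s
    have : P 0 = fun _ => (0 : J → ℝ) := by ext; simp [P]
    rw [this, reflectPath_const_zero]
  have hcont : ∀ v, Continuous fun s => f (reflectPath C (P v) s) := fun v =>
    hf.continuous.comp (continuous_reflectPath C (hP v))
  -- The Picard operator conjugated by the weight `exp (κ t)`. Clamping time at zero extends it to
  -- the whole line, and the weight makes its values bounded functions.
  let I : BoundedContinuousFunction ℝ (J → ℝ) → ℝ → J → ℝ := fun v t =>
    Real.exp (-(κ * max t 0)) • (x₀ + ∫ s in (0 : ℝ)..(max t 0), f (reflectPath C (P v) s))
  have hI : ∀ v, Continuous (I v) := by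
    intro v
    have h1 : Continuous fun t : ℝ => ∫ s in (0 : ℝ)..t, f (reflectPath C (P v) s) :=
      intervalIntegral.continuous_primitive (fun a b => (hcont v).intervalIntegrable a b) 0
    have h2 : Continuous fun t : ℝ => ∫ s in (0 : ℝ)..(max t 0), f (reflectPath C (P v) s) :=
      h1.comp (by fun_prop : Continuous fun t : ℝ => max t 0)
    exact (by fun_prop : Continuous fun t : ℝ => Real.exp (-(κ * max t 0))).smul
      (continuous_const.add h2)
  have hIb : ∀ v t, ‖I v t‖ ≤ ‖x₀‖ + (‖f 0‖ + K * (2 * ‖v‖)) / κ := by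
    intro v t
    have ht : (0 : ℝ) ≤ max t 0 := le_max_right _ _
    have h1 : ‖∫ s in (0 : ℝ)..(max t 0), f (reflectPath C (P v) s)‖
        ≤ (‖f 0‖ + K * (2 * ‖v‖)) / κ * Real.exp (κ * max t 0) := by
      refine norm_integral_le_exp hκ (by positivity) ht fun s hs _ => ?_
      have h2 := hf.dist_le_mul (reflectPath C (P v) s) 0
      have h3 := hPsub v 0 s hs
      rw [hP0, sub_zero, dist_zero_right] at h3
      rw [dist_eq_norm, dist_zero_right] at h2
      have h4 : ‖f (reflectPath C (P v) s)‖ ≤ ‖f 0‖ + ‖f (reflectPath C (P v) s) - f 0‖ := by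
        simpa using norm_add_le (f 0) (f (reflectPath C (P v) s) - f 0)
      have h5 : (1 : ℝ) ≤ Real.exp (κ * s) := Real.one_le_exp (by positivity)
      have h6 : ‖f 0‖ ≤ ‖f 0‖ * Real.exp (κ * s) := le_mul_of_one_le_right (norm_nonneg _) h5
      have h7 : K * ‖reflectPath C (P v) s‖ ≤ K * (2 * (Real.exp (κ * s) * ‖v‖)) := by gcongr
      calc _ ≤ ‖f 0‖ * Real.exp (κ * s) + K * (2 * (Real.exp (κ * s) * ‖v‖)) := by linarith
        _ = _ := by ring
    simp only [I]
    rw [norm_smul, Real.norm_eq_abs, abs_of_pos (Real.exp_pos _)]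
    have h8 : Real.exp (-(κ * max t 0)) ≤ 1 := Real.exp_le_one_iff.2 (by
      have := mul_nonneg hκ.le ht; linarith)
    calc _ ≤ Real.exp (-(κ * max t 0)) * (‖x₀‖ +
          (‖f 0‖ + K * (2 * ‖v‖)) / κ * Real.exp (κ * max t 0)) := by
            gcongr
            exact (norm_add_le _ _).trans (by gcongr)
      _ = Real.exp (-(κ * max t 0)) * ‖x₀‖ + (‖f 0‖ + K * (2 * ‖v‖)) / κ *
          (Real.exp (-(κ * max t 0)) * Real.exp (κ * max t 0)) := by ring
      _ ≤ _ := by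
        rw [← Real.exp_add, neg_add_cancel, Real.exp_zero, mul_one]
        gcongr
        exact mul_le_of_le_one_left (norm_nonneg _) h8
  let Φ : BoundedContinuousFunction ℝ (J → ℝ) → BoundedContinuousFunction ℝ (J → ℝ) :=
    fun v => BoundedContinuousFunction.ofNormedAddCommGroup (I v) (hI v) _ (hIb v)
  have hΦ : ContractingWith (1 / 2) Φ := by
    refine ⟨by norm_num, LipschitzWith.of_dist_le_mul fun u v => ?_⟩
    refine (BoundedContinuousFunction.dist_le (by positivity)).2 fun t => ?_
    have ht : (0 : ℝ) ≤ max t 0 := le_max_right _ _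
    show dist (I u t) (I v t) ≤ _
    simp only [I]
    rw [dist_eq_norm, ← smul_sub, norm_smul, Real.norm_eq_abs, abs_of_pos (Real.exp_pos _),
      add_sub_add_left_eq_sub, ← intervalIntegral.integral_sub
        ((hcont u).intervalIntegrable _ _) ((hcont v).intervalIntegrable _ _)]
    have h1 : ‖∫ s in (0 : ℝ)..(max t 0), (f (reflectPath C (P u) s) - f (reflectPath C (P v) s))‖
        ≤ (K * (2 * dist u v)) / κ * Real.exp (κ * max t 0) := by
      refine norm_integral_le_exp hκ (by positivity) ht fun s hs _ => ?_
      have h2 := hf.dist_le_mul (reflectPath C (P u) s) (reflectPath C (P v) s)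
      rw [dist_eq_norm, dist_eq_norm] at h2
      refine h2.trans ?_
      calc _ ≤ (K : ℝ) * (2 * (Real.exp (κ * s) * dist u v)) := by
            gcongr; exact hPsub u v s hs
        _ = _ := by ring
    calc _ ≤ Real.exp (-(κ * max t 0)) *
          ((K * (2 * dist u v)) / κ * Real.exp (κ * max t 0)) := by gcongr
      _ = (K * (2 * dist u v)) / κ * (Real.exp (-(κ * max t 0)) * Real.exp (κ * max t 0)) := by
          ring
      _ = (K * (2 * dist u v)) / κ := by
          rw [← Real.exp_add, neg_add_cancel, Real.exp_zero, mul_one]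
      _ ≤ _ := by
          rw [div_le_iff₀ hκ]
          have : 0 ≤ dist u v := dist_nonneg
          push_cast
          rw [hκdef]
          linarith
  let v := ContractingWith.fixedPoint Φ hΦ
  have hv : Φ v = v := hΦ.fixedPoint_isFixedPt
  refine ⟨P v, hP v, fun t ht => ?_⟩
  have h1 : v t = I v t := (DFunLike.congr_fun hv t).symm
  show Real.exp (κ * max t 0) • v t = _
  rw [h1]
  simp only [I]
  rw [smul_smul, ← Real.exp_add, add_neg_cancel, Real.exp_zero, one_smul, max_eq_left ht]

theorem lipschitzOnWith_of_integral_equation {g φ : ℝ → ℝ} (hφ : Continuous φ) {c : ℝ}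
    (hg : ∀ t, 0 ≤ t → g t = c + ∫ s in (0 : ℝ)..t, φ s) {T : ℝ} (hT : 0 ≤ T) :
    ∃ K : ℝ≥0, ∀ a b, 0 ≤ a → a ≤ b → b ≤ T → |g b - g a| ≤ K * (b - a) := by
  obtain ⟨k, hk⟩ := isCompact_Icc.exists_bound_of_continuousOn (hφ.continuousOn (s := Icc 0 T))
  have hk0 : 0 ≤ k := (norm_nonneg _).trans (hk 0 ⟨le_rfl, hT⟩)
  refine ⟨⟨k, hk0⟩, fun a b ha hab hb => ?_⟩
  rw [hg a ha, hg b (ha.trans hab), add_sub_add_left_eq_sub,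
    intervalIntegral.integral_interval_sub_left (hφ.intervalIntegrable _ _)
      (hφ.intervalIntegrable _ _)]
  have := intervalIntegral.norm_integral_le_of_norm_le_const (a := a) (b := b) (C := k) (f := φ)
    fun s hs => hk s (by
      rw [uIoc_of_le hab] at hs
      exact ⟨ha.trans hs.1.le, hs.2.trans hb⟩)
  rwa [abs_of_nonneg (sub_nonneg.2 hab)] at this

theorem lipschitzOnWith_uIcc_of_le {g : ℝ → ℝ} {T : ℝ} (hT : 0 ≤ T) {K : ℝ≥0}
    (h : ∀ a b, 0 ≤ a → a ≤ b → b ≤ T → |g b - g a| ≤ K * (b - a)) :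
    LipschitzOnWith K g (uIcc 0 T) := by
  rw [uIcc_of_le hT]
  refine LipschitzOnWith.of_dist_le_mul fun a ha b hb => ?_
  rcases le_total a b with hab | hab
  · rw [dist_comm, dist_comm a, Real.dist_eq, Real.dist_eq, abs_of_nonneg (sub_nonneg.2 hab)]
    exact h a b ha.1 hab hb.2
  · rw [Real.dist_eq, Real.dist_eq, abs_of_nonneg (sub_nonneg.2 hab)]
    exact h b a hb.1 hab ha.2

/-- The projected dynamics of a Lipschitz vector field have a global solution. -/
theorem exists_isProjTrajectory (C : Set J) {f : (J → ℝ) → J → ℝ} {K : ℝ≥0}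
    (hf : LipschitzWith K f) (x₀ : J → ℝ) (hx₀ : ∀ j ∈ C, 0 ≤ x₀ j) :
    ∃ x, IsProjTrajectory C f x ∧ x 0 = x₀ := by
  obtain ⟨w, hw, hweq⟩ := exists_reflected_integral_equation C hf x₀
  have hwj : ∀ j, Continuous fun s => w s j := fun j => (continuous_apply j).comp hw
  have hcont : Continuous fun s => f (reflectPath C w s) :=
    hf.continuous.comp (continuous_reflectPath C hw)
  have haj : ∀ j, Continuous fun s => f (reflectPath C w s) j :=
    fun j => (continuous_apply j).comp hcont
  have hint : ∀ j t, 0 ≤ t → w t j = x₀ j + ∫ s in (0 : ℝ)..t, f (reflectPath C w s) j := by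
    intro j t ht
    rw [hweq t ht, Pi.add_apply]
    congr 1
    exact ((ContinuousLinearMap.proj (R := ℝ) (φ := fun _ : J => ℝ) j).intervalIntegral_comp_comm
      (hcont.intervalIntegrable _ _)).symm
  have hw0 : w 0 = x₀ := by simpa using hweq 0 le_rfl
  have hx0 : reflectPath C w 0 = x₀ := by
    ext j
    by_cases hC : j ∈ C
    · simp only [reflectPath, hC, if_true]
      rw [skorokhodReg.zero (by rw [hw0]; exact hx₀ j hC), hw0, add_zero]
    · simp [reflectPath, hC, hw0]
  have hderiv : ∀ j t, 0 < t → HasDerivAt (fun s => w s j) (f (reflectPath C w t) j) t := by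
    intro j t ht
    have h1 : HasDerivAt (fun s => x₀ j + ∫ r in (0 : ℝ)..s, f (reflectPath C w r) j)
        (f (reflectPath C w t) j) t :=
      ((haj j).integral_hasStrictDerivAt 0 t).hasDerivAt.const_add _
    refine h1.congr_of_eventuallyEq ?_
    filter_upwards [lt_mem_nhds ht] with s hs using hint j s hs.le
  have hac : ∀ j t, 0 ≤ t → AbsolutelyContinuousOnInterval (fun s => w s j) 0 t := by
    intro j t ht
    obtain ⟨k, hk⟩ := lipschitzOnWith_of_integral_equation (haj j) (hint j) ht
    exact (lipschitzOnWith_uIcc_of_le ht hk).absolutelyContinuousOnInterval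
  have hac' : ∀ j t, 0 ≤ t →
      AbsolutelyContinuousOnInterval (skorokhodReg fun s => w s j) 0 t := by
    intro j t ht
    obtain ⟨k, hk⟩ := lipschitzOnWith_of_integral_equation (haj j) (hint j) ht
    refine (lipschitzOnWith_uIcc_of_le ht (K := k)
      fun a b ha hab hb => ?_).absolutelyContinuousOnInterval
    -- The regulator inherits the Lipschitz constant of the path.
    rw [abs_of_nonneg (sub_nonneg.2 (skorokhodReg.mono (hwj j) ha hab)), sub_le_iff_le_add']
    refine skorokhodReg.le_add (hwj j) ha hab (by have := sub_nonneg.2 hab; positivity)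
      fun r har hrb => ?_
    have h1 := (abs_le.1 (hk a r ha har (hrb.trans hb))).1
    have h2 : (k : ℝ) * (r - a) ≤ k * (b - a) := by gcongr
    linarith
  refine ⟨reflectPath C w, ⟨fun j hC => by rw [hx0]; exact hx₀ j hC, fun j t ht => ?_,
    fun j => ?_⟩, hx0⟩
  · by_cases hC : j ∈ C
    · simp only [reflectPath, hC, if_true]
      exact (hac j t ht).add (hac' j t ht)
    · simp only [reflectPath, hC, if_false, add_zero]
      exact hac j t ht
  · by_cases hC : j ∈ C
    -- The regulator is absolutely continuous on each `[0, n]`, hence differentiable almost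
    -- everywhere there. A countable intersection covers the half-line.
    · have hae : ∀ᵐ t : ℝ, 0 < t → DifferentiableAt ℝ (skorokhodReg fun s => w s j) t := by
        have h := ae_all_iff.2 fun n : ℕ =>
          (hac' j (n : ℝ) (Nat.cast_nonneg n)).ae_differentiableAt
        filter_upwards [h] with t ht h0
        obtain ⟨n, hn⟩ := exists_nat_ge t
        exact ht n (by rw [uIcc_of_le (Nat.cast_nonneg n)]; exact ⟨h0.le, hn⟩)
      filter_upwards [(ae_restrict_iff' measurableSet_Ioi).2 hae, ae_restrict_mem measurableSet_Ioi]
        with t hdiff ht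
      have := skorokhodReg.hasDerivAt_add (hwj j) ht (hderiv j t ht) hdiff
      simp only [projField, hC, if_true, reflectPath] at this ⊢
      exact this
    · filter_upwards [ae_restrict_mem measurableSet_Ioi] with t ht
      simp only [projField, hC, if_false, reflectPath, add_zero]
      exact hderiv j t ht

end ProjectedDynamics

/-! ### Weighted distances and dissipation along projected trajectories -/

theorem MPCData.LocallyAC.continuousOn {g : ℝ → ℝ} (hg : MPCData.LocallyAC g) :
    ContinuousOn g (Ici 0) := by
  intro t ht
  have h := (hg (t + 1) (by linarith [mem_Ici.1 ht])).continuousOn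
  rw [uIcc_of_le (by linarith [mem_Ici.1 ht])] at h
  refine (h t ⟨ht, by linarith⟩).mono_of_mem_nhdsWithin ?_
  rw [← Ici_inter_Iic]
  exact inter_mem self_mem_nhdsWithin (mem_nhdsWithin_of_mem_nhds (Iic_mem_nhds (by linarith)))

theorem MPCData.LocallyAC.mono {g : ℝ → ℝ} (hg : MPCData.LocallyAC g) {a b : ℝ} (ha : 0 ≤ a)
    (hab : a ≤ b) : AbsolutelyContinuousOnInterval g a b :=
  (hg b (ha.trans hab)).mono (by
    rw [uIcc_of_le hab, uIcc_of_le (ha.trans hab)]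
    exact Icc_subset_Icc ha le_rfl)

theorem MPCData.abs_posProj_le (a b : ℝ) : |MPCData.posProj a b| ≤ |a| := by
  unfold MPCData.posProj
  split_ifs
  · exact le_rfl
  · rcases le_total a 0 with h | h <;> simp [h]

theorem ContinuousOn.comp_max_zero {X : Type*} [TopologicalSpace X] {g : ℝ → X}
    (hg : ContinuousOn g (Ici 0)) : Continuous fun t => g (max t 0) :=
  hg.comp_continuous (by fun_prop) fun t => mem_Ici.2 (le_max_right t 0)

/-- The squared distance of `z` from `y` with weights `e`. -/
def weightedSqDist {J : Type*} [Fintype J] (e y z : J → ℝ) : ℝ := ∑ j, e j * (z j - y j) ^ 2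

section WeightedSqDist

variable {J : Type*} [Fintype J] {e : J → ℝ}

theorem continuous_weightedSqDist (e y : J → ℝ) : Continuous (weightedSqDist e y) := by
  unfold weightedSqDist; fun_prop

theorem weightedSqDist_self (e y : J → ℝ) : weightedSqDist e y y = 0 := by
  simp [weightedSqDist]

theorem weightedSqDist_nonneg (he : ∀ j, 0 < e j) (y z : J → ℝ) : 0 ≤ weightedSqDist e y z :=
  Finset.sum_nonneg fun j _ => mul_nonneg (he j).le (sq_nonneg _)

/-- The weighted distance dominates the sup distance. -/
theorem exists_mul_sq_dist_le_weightedSqDist (he : ∀ j, 0 < e j) :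
    ∃ c : ℝ, 0 < c ∧ ∀ y z : J → ℝ, c * dist z y ^ 2 ≤ weightedSqDist e y z := by
  obtain ⟨c, hc, hce⟩ : ∃ c : ℝ, 0 < c ∧ ∀ j, c ≤ e j := by
    rcases isEmpty_or_nonempty J with h | h
    · exact ⟨1, one_pos, fun j => h.elim j⟩
    · obtain ⟨j, hj⟩ := Finite.exists_min e
      exact ⟨e j, he j, hj⟩
  refine ⟨c, hc, fun y z => ?_⟩
  have h0 : 0 ≤ weightedSqDist e y z / c :=
    div_nonneg (weightedSqDist_nonneg he y z) hc.le
  have h1 : dist z y ≤ √(weightedSqDist e y z / c) := by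
    refine (dist_pi_le_iff (Real.sqrt_nonneg _)).2 fun j => ?_
    rw [Real.dist_eq]
    refine Real.abs_le_sqrt ?_
    rw [le_div_iff₀ hc]
    calc (z j - y j) ^ 2 * c ≤ e j * (z j - y j) ^ 2 := by
          rw [mul_comm]; gcongr; exact hce j
      _ ≤ _ := Finset.single_le_sum (f := fun j => e j * (z j - y j) ^ 2)
          (fun j _ => mul_nonneg (he j).le (sq_nonneg _)) (Finset.mem_univ j)
  calc c * dist z y ^ 2 ≤ c * √(weightedSqDist e y z / c) ^ 2 := by gcongr
    _ = _ := by rw [Real.sq_sqrt h0]; field_simp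

theorem tendsto_of_weightedSqDist {ι : Type*} {l : Filter ι} (he : ∀ j, 0 < e j) {y : J → ℝ}
    {x : ι → J → ℝ} (h : Tendsto (fun t => weightedSqDist e y (x t)) l (𝓝 0)) :
    Tendsto x l (𝓝 y) := by
  obtain ⟨c, hc, hle⟩ := exists_mul_sq_dist_le_weightedSqDist he
  rw [tendsto_iff_dist_tendsto_zero]
  have h1 : Tendsto (fun t => √(weightedSqDist e y (x t) / c)) l (𝓝 0) := by
    have := (h.div_const c).sqrt
    simpa using this
  refine squeeze_zero (fun _ => dist_nonneg) (fun t => ?_) h1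
  refine Real.le_sqrt_of_sq_le ?_
  rw [le_div_iff₀ hc, mul_comm]
  exact hle y (x t)

end WeightedSqDist

namespace IsProjTrajectory

variable {J : Type*} [Fintype J] {C : Set J} {f : (J → ℝ) → J → ℝ} {x : ℝ → J → ℝ}

-- After the last time at which the coordinate is nonnegative it would be negative, where the
-- projected velocity is `max · 0 ≥ 0`; so it could not have decreased.
omit [Fintype J] in
theorem nonneg (hx : IsProjTrajectory C f x) {j : J} (hj : j ∈ C) {t : ℝ} (ht : 0 ≤ t) :
    0 ≤ x t j := by
  by_contra! hneg
  have hcont : ContinuousOn (fun s => x s j) (Icc 0 t) :=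
    (hx.ac j).continuousOn.mono Icc_subset_Ici_self
  let S : Set ℝ := Icc 0 t ∩ (fun s => x s j) ⁻¹' Ici 0
  have hS : IsCompact S :=
    isCompact_Icc.of_isClosed_subset (hcont.preimage_isClosed_of_isClosed isClosed_Icc isClosed_Ici)
      inter_subset_left
  have hne : S.Nonempty := ⟨0, ⟨le_rfl, ht⟩, hx.init j hj⟩
  have hs0 := hS.sSup_mem hne
  set s₀ := sSup S
  have hlt : ∀ s, s₀ < s → s ≤ t → x s j < 0 := by
    intro s hs hst
    by_contra! h
    exact absurd (le_csSup hS.bddAbove ⟨⟨hs0.1.1.trans hs.le, hst⟩, h⟩) (not_le.2 hs)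
  have h1 := ((hx.ac j).mono hs0.1.1 hs0.1.2).neg.sub_le_integral (φ := fun _ => 0) hs0.1.2
    continuousOn_const ?_
  · have h2 : 0 ≤ x s₀ j := hs0.2
    simp at h1
    linarith
  · filter_upwards [ae_restrict_Ioo_of_Ioi hs0.1.1 (hx.ode j), ae_restrict_mem measurableSet_Ioo]
      with s hs hmem
    refine ⟨_, hs.neg, ?_⟩
    simp only [projField, hj, if_true, MPCData.posProj, (hlt s hmem.1 hmem.2.le).not_gt, if_false]
    simp

omit [Fintype J] in
theorem continuousOn (hx : IsProjTrajectory C f x) : ContinuousOn x (Ici 0) :=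
  continuousOn_pi.2 fun j => (hx.ac j).continuousOn

/-- Dissipation inequality along trajectories. -/
theorem weightedSqDist_sub_le (hx : IsProjTrajectory C f x) {e y : J → ℝ} {φ : (J → ℝ) → ℝ}
    (hφ : Continuous φ)
    (hdiss : ∀ z : J → ℝ, (∀ j ∈ C, 0 ≤ z j) →
      ∑ j, e j * (z j - y j) * projField C f z j ≤ -φ z) {a b : ℝ} (ha : 0 ≤ a) (hab : a ≤ b) :
    weightedSqDist e y (x b) - weightedSqDist e y (x a) ≤ ∫ t in a..b, -(2 * φ (x t)) := by
  have hac : ∀ s : Finset J,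
      AbsolutelyContinuousOnInterval (fun t => ∑ j ∈ s, e j * (x t j - y j) ^ 2) a b := by
    classical
    intro s
    induction s using Finset.induction_on with
    | empty =>
      simpa using ((LipschitzWith.const (0 : ℝ)).lipschitzOnWith
        (s := uIcc a b)).absolutelyContinuousOnInterval
    | insert j s hj ih =>
      simp only [Finset.sum_insert hj]
      have h1 : AbsolutelyContinuousOnInterval (fun t => x t j - y j) a b :=
        ((hx.ac j).mono ha hab).sub
          ((LipschitzWith.const (y j)).lipschitzOnWith
            (s := uIcc a b)).absolutelyContinuousOnInterval
      have h2 := (h1.mul h1).const_mul (e j)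
      have h3 := h2.add ih
      refine (congrArg (AbsolutelyContinuousOnInterval · a b) ?_).mpr h3
      ext t
      simp [sq]
  refine (hac Finset.univ).sub_le_integral hab ?_ ?_
  · exact ((hφ.comp_continuousOn hx.continuousOn).const_smul (2 : ℝ)).neg.mono
      fun t ht => ha.trans ht.1
  · filter_upwards [ae_all_iff.2 fun j => ae_restrict_Ioo_of_Ioi ha (hx.ode j),
      ae_restrict_mem measurableSet_Ioo] with t ht hmem
    refine ⟨∑ j, e j * (2 * (x t j - y j) * projField C f (x t) j), ?_, ?_⟩
    · refine HasDerivAt.fun_sum fun j _ => ?_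
      have := (((ht j).sub_const (y j)).pow 2).const_mul (e j)
      simpa using this
    · have := hdiss (x t) fun j hj => hx.nonneg hj (ha.trans hmem.1.le)
      calc _ = 2 * ∑ j, e j * (x t j - y j) * projField C f (x t) j := by
            rw [Finset.mul_sum]; exact Finset.sum_congr rfl fun j _ => by ring
        _ ≤ _ := by linarith

theorem weightedSqDist_le (hx : IsProjTrajectory C f x) {e y : J → ℝ}
    (hdiss : ∀ z : J → ℝ, (∀ j ∈ C, 0 ≤ z j) →
      ∑ j, e j * (z j - y j) * projField C f z j ≤ 0) {a b : ℝ} (ha : 0 ≤ a) (hab : a ≤ b) :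
    weightedSqDist e y (x b) ≤ weightedSqDist e y (x a) := by
  have := hx.weightedSqDist_sub_le (φ := fun _ => 0) continuous_const
    (by simpa using hdiss) ha hab
  simp at this
  linarith

theorem exists_norm_le (hx : IsProjTrajectory C f x) {e y : J → ℝ} (he : ∀ j, 0 < e j)
    (hdiss : ∀ z : J → ℝ, (∀ j ∈ C, 0 ≤ z j) →
      ∑ j, e j * (z j - y j) * projField C f z j ≤ 0) :
    ∃ R, ∀ t, 0 ≤ t → x t ∈ Metric.closedBall y R := by
  obtain ⟨c, hc, hle⟩ := exists_mul_sq_dist_le_weightedSqDist he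
  refine ⟨√(weightedSqDist e y (x 0) / c), fun t ht => Real.le_sqrt_of_sq_le ?_⟩
  rw [le_div_iff₀ hc, mul_comm]
  exact (hle y (x t)).trans (hx.weightedSqDist_le hdiss le_rfl ht)

/-- The projected field is discontinuous, but coordinatewise no larger than `f`. On a bounded
trajectory the speed is therefore bounded and the trajectory is Lipschitz, which is all that
Barbalat's lemma requires. -/
theorem uniformContinuousOn_comp (hx : IsProjTrajectory C f x) (hf : Continuous f) {y : J → ℝ}
    {R : ℝ} (hR : ∀ t, 0 ≤ t → x t ∈ Metric.closedBall y R) {ψ : (J → ℝ) → ℝ}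
    (hψ : Continuous ψ) : UniformContinuousOn (fun t => ψ (x t)) (Ici 0) := by
  have hK := isCompact_closedBall y R
  refine (hK.uniformContinuousOn_of_continuous hψ.continuousOn).comp ?_ fun t ht => hR t ht
  obtain ⟨M, hM⟩ := hK.exists_bound_of_continuousOn hf.continuousOn
  have hM0 : 0 ≤ M := (norm_nonneg _).trans (hM _ (hR 0 le_rfl))
  have hb : ∀ t, 0 ≤ t → ∀ j, |projField C f (x t) j| ≤ M := by
    intro t ht j
    refine le_trans ?_ ((norm_le_pi_norm (f (x t)) j).trans (hM _ (hR t ht)))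
    unfold projField
    split_ifs
    · exact MPCData.abs_posProj_le _ _
    · exact le_rfl
  have key : ∀ a b, 0 ≤ a → a ≤ b → dist (x b) (x a) ≤ M * (b - a) := by
    intro a b ha hab
    refine (dist_pi_le_iff (mul_nonneg hM0 (sub_nonneg.2 hab))).2 fun j => ?_
    have h1 := ((hx.ac j).mono ha hab).sub_le_integral (φ := fun _ => M) hab continuousOn_const
      (by filter_upwards [ae_restrict_Ioo_of_Ioi ha (hx.ode j), ae_restrict_mem measurableSet_Ioo]
            with s hs hmem using ⟨_, hs, (abs_le.1 (hb s (ha.trans hmem.1.le) j)).2⟩)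
    have h2 := ((hx.ac j).mono ha hab).neg.sub_le_integral (φ := fun _ => M) hab continuousOn_const
      (by filter_upwards [ae_restrict_Ioo_of_Ioi ha (hx.ode j), ae_restrict_mem measurableSet_Ioo]
            with s hs hmem
          exact ⟨_, hs.neg, by linarith [(abs_le.1 (hb s (ha.trans hmem.1.le) j)).1]⟩)
    simp at h1 h2
    rw [Real.dist_eq, abs_le]
    constructor <;> linarith
  refine LipschitzOnWith.uniformContinuousOn (K := ⟨M, hM0⟩) ?_
  refine LipschitzOnWith.of_dist_le_mul fun a ha b hb => ?_
  rcases le_total a b with hab | hab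
  · rw [dist_comm, dist_comm a, Real.dist_eq, abs_of_nonneg (sub_nonneg.2 hab)]
    exact key a b ha hab
  · rw [Real.dist_eq, abs_of_nonneg (sub_nonneg.2 hab)]
    exact key b a hb hab

/-- The dissipation rate vanishes asymptotically. -/
theorem tendsto_dissipation (hx : IsProjTrajectory C f x) (hf : Continuous f) {e y : J → ℝ}
    (he : ∀ j, 0 < e j) {φ : (J → ℝ) → ℝ} (hφ : Continuous φ)
    (hφ0 : ∀ z : J → ℝ, (∀ j ∈ C, 0 ≤ z j) → 0 ≤ φ z)
    (hdiss : ∀ z : J → ℝ, (∀ j ∈ C, 0 ≤ z j) →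
      ∑ j, e j * (z j - y j) * projField C f z j ≤ -φ z) :
    Tendsto (fun t => φ (x t)) atTop (𝓝 0) := by
  obtain ⟨R, hR⟩ := hx.exists_norm_le he (y := y)
    fun z hz => (hdiss z hz).trans (neg_nonpos.2 (hφ0 z hz))
  have huc := hx.uniformContinuousOn_comp hf hR hφ
  have hcont : Continuous fun t => φ (x (max t 0)) := huc.continuousOn.comp_max_zero
  -- Barbalat's lemma is applied to the primitive of the dissipation rate, which is monotone and
  -- bounded by half of the initial weighted distance.
  have hmono : Monotone fun t => ∫ s in (0 : ℝ)..t, φ (x (max s 0)) := by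
    intro a b hab
    have h1 : 0 ≤ ∫ s in a..b, φ (x (max s 0)) :=
      intervalIntegral.integral_nonneg hab fun s _ =>
        hφ0 _ fun j hj => hx.nonneg hj (le_max_right _ _)
    have h2 := intervalIntegral.integral_add_adjacent_intervals
      (hcont.intervalIntegrable (μ := volume) 0 a) (hcont.intervalIntegrable a b)
    simp only
    linarith
  have hbdd : BddAbove (range fun t => ∫ s in (0 : ℝ)..t, φ (x (max s 0))) := by
    refine ⟨weightedSqDist e y (x 0) / 2, ?_⟩
    rintro _ ⟨t, rfl⟩
    have h0 := hmono (le_max_left t 0)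
    have h1 := hx.weightedSqDist_sub_le hφ hdiss le_rfl (le_max_right t 0)
    have h2 := weightedSqDist_nonneg he y (x (max t 0))
    have h3 : ∫ s in (0 : ℝ)..(max t 0), -(2 * φ (x s))
        = -(2 * ∫ s in (0 : ℝ)..(max t 0), φ (x (max s 0))) := by
      rw [← intervalIntegral.integral_const_mul, ← intervalIntegral.integral_neg]
      refine intervalIntegral.integral_congr fun s hs => ?_
      rw [uIcc_of_le (le_max_right t 0)] at hs
      simp only [max_eq_left hs.1]
    simp only at h0 ⊢
    linarith
  have hlim := tendsto_atTop_ciSup hmono hbdd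
  refine tendsto_zero_of_uniformContinuousOn_deriv hlim (fun t ht => ?_) huc
  have := (hcont.integral_hasStrictDerivAt 0 t).hasDerivAt
  simpa only [max_eq_left ht.le] using this

/-- If an unconstrained coordinate of a bounded trajectory converges, then so does its derivative,
to zero. -/
theorem tendsto_field_of_tendsto (hx : IsProjTrajectory C f x) (hf : Continuous f) {y : J → ℝ}
    {R : ℝ} (hR : ∀ t, 0 ≤ t → x t ∈ Metric.closedBall y R) {j : J} (hj : j ∉ C) {l : ℝ}
    (hl : Tendsto (fun t => x t j) atTop (𝓝 l)) :
    Tendsto (fun t => f (x t) j) atTop (𝓝 0) := by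
  have huc := hx.uniformContinuousOn_comp hf hR ((continuous_apply j).comp hf)
  refine tendsto_zero_of_uniformContinuousOn_deriv hl (fun t ht => ?_) huc
  have hcont : Continuous fun t => f (x (max t 0)) j := huc.continuousOn.comp_max_zero
  -- Without projection the velocity is continuous in time, so the integral form upgrades the
  -- almost-everywhere derivative to a derivative at every positive time.
  have heq : ∀ s, 0 < s → x s j = x 0 j + ∫ r in (0 : ℝ)..s, f (x (max r 0)) j := by
    intro s hs
    rw [← ((hx.ac j).mono le_rfl hs.le).sub_eq_integral hs.le]
    · ring
    · filter_upwards [ae_restrict_Ioo_of_Ioi le_rfl (hx.ode j), ae_restrict_mem measurableSet_Ioo]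
        with r hr hmem
      rw [max_eq_left hmem.1.le]
      simpa only [projField, hj, if_false] using hr
  have h1 := ((hcont.integral_hasStrictDerivAt 0 t).hasDerivAt).const_add (x 0 j)
  rw [max_eq_left ht.le] at h1
  refine h1.congr_of_eventuallyEq ?_
  filter_upwards [lt_mem_nhds ht] with s hs using heq s hs

/-- A trajectory converges to any cluster point from which the distance does not increase. -/
theorem tendsto_of_mapClusterPt (hx : IsProjTrajectory C f x) {e y : J → ℝ} (he : ∀ j, 0 < e j)
    (hdiss : ∀ z : J → ℝ, (∀ j ∈ C, 0 ≤ z j) →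
      ∑ j, e j * (z j - y j) * projField C f z j ≤ 0) (hy : MapClusterPt y atTop x) :
    Tendsto x atTop (𝓝 y) := by
  refine tendsto_of_weightedSqDist he ?_
  rw [tendsto_order]
  refine ⟨fun a ha => Eventually.of_forall fun t => ha.trans_le (weightedSqDist_nonneg he y _),
    fun a ha => ?_⟩
  have h1 : ∀ᶠ z in 𝓝 y, weightedSqDist e y z < a :=
    (continuous_weightedSqDist e y).continuousAt.eventually_lt_const
      (by rwa [weightedSqDist_self])
  obtain ⟨s, hs, hs0⟩ := ((hy.frequently h1).and_eventually (eventually_ge_atTop 0)).exists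
  filter_upwards [eventually_ge_atTop s] with t ht
  exact (hx.weightedSqDist_le hdiss hs0 ht).trans_lt hs

end IsProjTrajectory

theorem MapClusterPt.eq_of_tendsto {ι X Y : Type*} [TopologicalSpace X] [TopologicalSpace Y]
    [T2Space Y] {l : Filter ι} {u : ι → X} {x : X} (hx : MapClusterPt x l u) {ψ : X → Y}
    (hψ : ContinuousAt ψ x) {c : Y} (h : Tendsto (fun i => ψ (u i)) l (𝓝 c)) : ψ x = c := by
  have h1 : MapClusterPt (ψ x) l (ψ ∘ u) := hx.continuousAt_comp hψ
  have h2 : (𝓝 (ψ x) ⊓ 𝓝 c).NeBot := NeBot.mono h1 (inf_le_inf_left _ h)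
  exact eq_of_nhds_neBot h2

/-! ### Farkas' lemma and optimality conditions for least squares programs -/

/-- Farkas' lemma: a linear functional that is nonnegative wherever finitely many functionals are
nonnegative is a conic combination of them. -/
theorem farkas_lemma {W ι : Type*} [AddCommGroup W] [Module ℝ W] (s : Finset ι)
    (a : ι → W →ₗ[ℝ] ℝ) (b : W →ₗ[ℝ] ℝ) (h : ∀ w, (∀ i ∈ s, 0 ≤ a i w) → 0 ≤ b w) :
    ∃ c : ι → ℝ, (∀ i, 0 ≤ c i) ∧ ∀ w, b w = ∑ i ∈ s, c i * a i w := by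
  classical
  induction s using Finset.induction_on generalizing a b with
  | empty =>
    refine ⟨0, fun _ => le_rfl, fun w => ?_⟩
    have h1 := h w (by simp)
    have h2 := h (-w) (by simp)
    rw [map_neg] at h2
    simp only [Finset.sum_empty]
    linarith
  | insert j s hj ih =>
    by_cases hb : ∀ w, (∀ i ∈ s, 0 ≤ a i w) → 0 ≤ b w
    · obtain ⟨c, hc, hcb⟩ := ih a b hb
      refine ⟨Function.update c j 0, fun i => ?_, fun w => ?_⟩
      · by_cases hi : i = j <;> simp [hi, hc]
      · rw [Finset.sum_insert hj, Function.update_self, zero_mul, zero_add, hcb w]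
        refine Finset.sum_congr rfl fun i hi => ?_
        rw [Function.update_of_ne (ne_of_mem_of_not_mem hi hj)]
    · push Not at hb
      obtain ⟨w₁, hw₁, hbw₁⟩ := hb
      have hjw₁ : a j w₁ < 0 := by
        by_contra! hcon
        exact absurd (h w₁ (by simpa [Finset.forall_mem_insert, hcon] using hw₁)) (not_le.2 hbw₁)
      -- With `a j w₀ = -1`, the map `w ↦ w + a j w • w₀` projects onto the kernel of `a j`. The
      -- induction hypothesis is applied to the functionals composed with it, for which constraint
      -- `j` holds trivially.
      obtain ⟨w₀, hw₀, hbw₀, hjw₀⟩ : ∃ w₀, (∀ i ∈ s, 0 ≤ a i w₀) ∧ b w₀ < 0 ∧ a j w₀ = -1 := by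
        have hpos : 0 < (-(a j w₁))⁻¹ := inv_pos.2 (by linarith)
        refine ⟨(-(a j w₁))⁻¹ • w₁, fun i hi => ?_, ?_, ?_⟩
        · rw [map_smul]; exact mul_nonneg hpos.le (hw₁ i hi)
        · rw [map_smul]; exact mul_neg_of_pos_of_neg hpos hbw₁
        · rw [map_smul, smul_eq_mul, inv_neg, neg_mul, inv_mul_cancel₀ hjw₁.ne]
      obtain ⟨c, hc, hcb⟩ := ih (fun i => a i + a i w₀ • a j) (b + b w₀ • a j) (by
        intro w hw
        have h1 := h (w + a j w • w₀) (by
          intro i hi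
          rw [map_add, map_smul, smul_eq_mul]
          rcases Finset.mem_insert.1 hi with rfl | hi
          · rw [hjw₀]; linarith
          · have := hw i hi
            simp only [LinearMap.add_apply, LinearMap.smul_apply, smul_eq_mul] at this
            linarith)
        rw [map_add, map_smul, smul_eq_mul] at h1
        simp only [LinearMap.add_apply, LinearMap.smul_apply, smul_eq_mul]
        linarith)
      -- Undoing the projection collects this coefficient of `a j`; it is nonnegative because `b w₀
      -- < 0` and every `a i w₀ ≥ 0`.
      refine ⟨Function.update c j (∑ i ∈ s, c i * a i w₀ - b w₀), fun i => ?_, fun w => ?_⟩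
      · by_cases hi : i = j
        · subst hi
          rw [Function.update_self]
          have := Finset.sum_nonneg fun i hi => mul_nonneg (hc i) (hw₀ i hi)
          linarith
        · rw [Function.update_of_ne hi]; exact hc i
      · have h1 := hcb w
        simp only [LinearMap.add_apply, LinearMap.smul_apply, smul_eq_mul, mul_add,
          Finset.sum_add_distrib] at h1
        rw [Finset.sum_insert hj, Function.update_self]
        have h2 : ∑ i ∈ s, Function.update c j (∑ i ∈ s, c i * a i w₀ - b w₀) i * a i w
            = ∑ i ∈ s, c i * a i w := Finset.sum_congr rfl fun i hi => by
          rw [Function.update_of_ne (ne_of_mem_of_not_mem hi hj)]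
        have h3 : ∑ i ∈ s, c i * (a i w₀ * a j w) = (∑ i ∈ s, c i * a i w₀) * a j w := by
          rw [Finset.sum_mul]; exact Finset.sum_congr rfl fun i _ => by ring
        rw [h2]
        linarith

/-- Division by `t` and `t → 0⁺` turn minimality along a ray into a first-order condition. -/
theorem nonneg_of_eventually_quadratic {a b : ℝ}
    (h : ∀ᶠ t in 𝓝[>] (0 : ℝ), 0 ≤ t * a + t ^ 2 * b) : 0 ≤ a := by
  have h1 : Tendsto (fun t : ℝ => a + t * b) (𝓝[>] 0) (𝓝 a) := by
    have : Tendsto (fun t : ℝ => a + t * b) (𝓝 0) (𝓝 (a + 0 * b)) :=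
      (by fun_prop : Continuous fun t : ℝ => a + t * b).tendsto 0
    rw [zero_mul, add_zero] at this
    exact this.mono_left nhdsWithin_le_nhds
  refine ge_of_tendsto h1 ?_
  filter_upwards [h, self_mem_nhdsWithin] with t ht ht0
  have h2 : 0 ≤ t * (a + t * b) := by linear_combination ht
  exact nonneg_of_mul_nonneg_right h2 ht0

/-- A linear least squares objective with affine inequality and equality constraints. -/
structure LeastSquaresProgram (E ν ι κ : Type*) [AddCommGroup E] [Module ℝ E] where
  B : E →ₗ[ℝ] ν → ℝ
  r : ν → ℝ
  R₁ : E →ₗ[ℝ] ι → ℝ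
  r₁ : ι → ℝ
  R₂ : E →ₗ[ℝ] κ → ℝ
  r₂ : κ → ℝ

namespace LeastSquaresProgram

variable {E ν ι κ : Type*} [AddCommGroup E] [Module ℝ E] [Fintype ν] [Fintype ι] [Fintype κ]

def obj (Q : LeastSquaresProgram E ν ι κ) (Y : E) : ℝ := ∑ a, (Q.B Y a - Q.r a) ^ 2

def lag (Q : LeastSquaresProgram E ν ι κ) (Y : E) (η : ι → ℝ) (μ : κ → ℝ) : ℝ :=
  Q.obj Y + ∑ i, η i * (Q.R₁ Y i - Q.r₁ i) + ∑ k, μ k * (Q.R₂ Y k - Q.r₂ k)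

/-- The derivative of the Lagrangian at `Y` in the direction `v`. -/
def dlag (Q : LeastSquaresProgram E ν ι κ) (Y : E) (η : ι → ℝ) (μ : κ → ℝ) (v : E) : ℝ :=
  2 * ∑ a, (Q.B Y a - Q.r a) * Q.B v a + ∑ i, η i * Q.R₁ v i + ∑ k, μ k * Q.R₂ v k

structure Feas (Q : LeastSquaresProgram E ν ι κ) (Y : E) : Prop where
  ineq : ∀ i, Q.R₁ Y i ≤ Q.r₁ i
  eq : ∀ k, Q.R₂ Y k = Q.r₂ k

/-- The Karush–Kuhn–Tucker conditions. -/
structure KKT (Q : LeastSquaresProgram E ν ι κ) (Y : E) (η : ι → ℝ) (μ : κ → ℝ) : Prop where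
  feas : Q.Feas Y
  nonneg : ∀ i, 0 ≤ η i
  compl : ∀ i, η i * (Q.R₁ Y i - Q.r₁ i) = 0
  stat : ∀ v, Q.dlag Y η μ v = 0

variable (Q : LeastSquaresProgram E ν ι κ)

/-- The expansion is exact because the objective is quadratic and the constraints are affine. The
remainder is nonnegative and free of the multipliers, which gives global optimality, quadratic
growth and the directional derivative at once. -/
theorem lag_add (Y v : E) (η : ι → ℝ) (μ : κ → ℝ) :
    Q.lag (Y + v) η μ = Q.lag Y η μ + Q.dlag Y η μ v + ∑ a, Q.B v a ^ 2 := by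
  simp only [lag, obj, dlag, map_add, Pi.add_apply, Finset.mul_sum]
  have h1 : ∑ a, (Q.B Y a + Q.B v a - Q.r a) ^ 2 = ∑ a, (Q.B Y a - Q.r a) ^ 2
      + ∑ a, 2 * ((Q.B Y a - Q.r a) * Q.B v a) + ∑ a, Q.B v a ^ 2 := by
    rw [← Finset.sum_add_distrib, ← Finset.sum_add_distrib]
    exact Finset.sum_congr rfl fun a _ => by ring
  have h2 : ∑ i, η i * (Q.R₁ Y i + Q.R₁ v i - Q.r₁ i)
      = ∑ i, η i * (Q.R₁ Y i - Q.r₁ i) + ∑ i, η i * Q.R₁ v i := by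
    rw [← Finset.sum_add_distrib]
    exact Finset.sum_congr rfl fun a _ => by ring
  have h3 : ∑ i, μ i * (Q.R₂ Y i + Q.R₂ v i - Q.r₂ i)
      = ∑ i, μ i * (Q.R₂ Y i - Q.r₂ i) + ∑ i, μ i * Q.R₂ v i := by
    rw [← Finset.sum_add_distrib]
    exact Finset.sum_congr rfl fun a _ => by ring
  rw [h1, h2, h3]
  ring

theorem dlag_smul (Y v : E) (η : ι → ℝ) (μ : κ → ℝ) (t : ℝ) :
    Q.dlag Y η μ (t • v) = t * Q.dlag Y η μ v := by
  simp only [dlag, map_smul, Pi.smul_apply, smul_eq_mul, mul_add, Finset.mul_sum]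
  congr 1
  · congr 1 <;> exact Finset.sum_congr rfl fun a _ => by ring
  · exact Finset.sum_congr rfl fun a _ => by ring

theorem lag_add_smul (Y v : E) (η : ι → ℝ) (μ : κ → ℝ) (t : ℝ) :
    Q.lag (Y + t • v) η μ
      = Q.lag Y η μ + (t * Q.dlag Y η μ v + t ^ 2 * ∑ a, Q.B v a ^ 2) := by
  rw [lag_add, dlag_smul, add_assoc]
  congr 2
  rw [Finset.mul_sum]
  exact Finset.sum_congr rfl fun a _ => by simp [mul_pow]

theorem lag_zero (Y : E) : Q.lag Y 0 0 = Q.obj Y := by simp [lag]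

/-- Saddle points of the Lagrangian over nonnegative multipliers satisfy the KKT conditions, and
conversely. -/
theorem kkt_iff_saddle (Y : E) (η : ι → ℝ) (μ : κ → ℝ) :
    Q.KKT Y η μ ↔ (∀ i, 0 ≤ η i) ∧
      (∀ (η' : ι → ℝ) (μ' : κ → ℝ), (∀ i, 0 ≤ η' i) → Q.lag Y η' μ' ≤ Q.lag Y η μ) ∧
      ∀ Y', Q.lag Y η μ ≤ Q.lag Y' η μ := by
  classical
  constructor
  · intro h
    refine ⟨h.nonneg, fun η' μ' hη' => ?_, fun Y' => ?_⟩
    · simp only [lag, h.compl, h.feas.eq, sub_self, mul_zero, Finset.sum_const_zero, add_zero]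
      have := Finset.sum_nonpos fun i (_ : i ∈ Finset.univ) =>
        mul_nonpos_of_nonneg_of_nonpos (hη' i) (sub_nonpos.2 (h.feas.ineq i))
      linarith
    · have h1 := Q.lag_add Y (Y' - Y) η μ
      rw [add_sub_cancel, h.stat] at h1
      have := Finset.sum_nonneg fun a (_ : a ∈ Finset.univ) => sq_nonneg (Q.B (Y' - Y) a)
      linarith
  · rintro ⟨hη, hmax, hmin⟩
    have hineq : ∀ i, Q.R₁ Y i - Q.r₁ i ≤ 0 := by
      intro i
      -- Raising one multiplier by 1 changes the Lagrangian by exactly the constraint value.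
      have h1 := hmax (η + Pi.single i 1) μ fun j => by
        by_cases hj : j = i
        · subst hj; simpa using add_nonneg (hη j) zero_le_one
        · simpa [hj] using hη j
      simp only [lag, Pi.add_apply, add_mul, Finset.sum_add_distrib, Pi.single_apply, ite_mul,
        one_mul, zero_mul, Finset.sum_ite_eq', Finset.mem_univ, if_true] at h1
      linarith
    have heq : ∀ k, Q.R₂ Y k - Q.r₂ k = 0 := by
      intro k
      have h1 := hmax η (μ + Pi.single k 1) hη
      have h2 := hmax η (μ - Pi.single k 1) hη
      simp only [lag, Pi.add_apply, Pi.sub_apply, sub_mul, add_mul, Finset.sum_sub_distrib,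
        Finset.sum_add_distrib, Pi.single_apply, ite_mul,
        one_mul, zero_mul, Finset.sum_ite_eq', Finset.mem_univ, if_true] at h1 h2
      linarith
    refine ⟨⟨fun i => sub_nonpos.1 (hineq i), fun k => sub_eq_zero.1 (heq k)⟩, hη, fun i => ?_,
      fun v => ?_⟩
    -- Setting the multiplier to zero cannot increase the Lagrangian, so the product is nonnegative;
    -- feasibility gives the opposite sign.
    · have h1 := hmax (η - Pi.single i (η i)) μ fun j => by
        by_cases hj : j = i
        · subst hj; simp
        · simpa [hj] using hη j
      simp only [lag, Pi.sub_apply, sub_mul, Finset.sum_sub_distrib, Pi.single_apply, ite_mul,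
        zero_mul, Finset.sum_ite_eq', Finset.mem_univ, if_true] at h1
      have := mul_nonpos_of_nonneg_of_nonpos (hη i) (hineq i)
      linarith
    · have key : ∀ v, 0 ≤ Q.dlag Y η μ v := fun v =>
        nonneg_of_eventually_quadratic (b := ∑ a, Q.B v a ^ 2) <| Eventually.of_forall fun t => by
          have := hmin (Y + t • v)
          rw [lag_add_smul] at this
          linarith
      have h1 := key ((-1 : ℝ) • v)
      rw [dlag_smul] at h1
      linarith [key v]

/-- A KKT point is a strict global minimizer up to the kernel of `B`. -/
theorem KKT.obj_add_le {Q : LeastSquaresProgram E ν ι κ} {Y : E} {η : ι → ℝ} {μ : κ → ℝ}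
    (h : Q.KKT Y η μ) {Y' : E} (hY' : Q.Feas Y') :
    Q.obj Y + ∑ a, Q.B (Y' - Y) a ^ 2 ≤ Q.obj Y' := by
  have h1 := Q.lag_add Y (Y' - Y) η μ
  rw [add_sub_cancel, h.stat] at h1
  simp only [lag, h.compl, h.feas.eq, hY'.eq, sub_self, mul_zero, Finset.sum_const_zero,
    add_zero] at h1
  have := Finset.sum_nonpos fun i (_ : i ∈ Finset.univ) =>
    mul_nonpos_of_nonneg_of_nonpos (h.nonneg i) (sub_nonpos.2 (hY'.ineq i))
  linarith

/-- Minimizers of a linearly constrained least squares problem have multipliers; no constraint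
qualification is needed. -/
theorem exists_kkt {Y : E} (hY : Q.Feas Y) (hopt : ∀ Y', Q.Feas Y' → Q.obj Y ≤ Q.obj Y') :
    ∃ η μ, Q.KKT Y η μ := by
  classical
  -- Only active constraints generate the cone, inactive ones being replaced by the zero functional.
  -- Equalities enter as pairs of opposite inequalities.
  let act : ι → Prop := fun i => Q.R₁ Y i = Q.r₁ i
  let a : ι ⊕ κ ⊕ κ → E →ₗ[ℝ] ℝ := Sum.elim
    (fun i => if act i then -(LinearMap.proj i ∘ₗ Q.R₁) else 0)
    (Sum.elim (fun k => LinearMap.proj k ∘ₗ Q.R₂) (fun k => -(LinearMap.proj k ∘ₗ Q.R₂)))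
  let b : E →ₗ[ℝ] ℝ :=
    { toFun := Q.dlag Y 0 0
      map_add' := fun u v => by
        simp only [dlag, map_add, Pi.add_apply, Pi.zero_apply, zero_mul, Finset.sum_const_zero,
          add_zero, ← mul_add, ← Finset.sum_add_distrib]
      map_smul' := fun t v => Q.dlag_smul Y v 0 0 t }
  obtain ⟨c, hc, hcb⟩ := farkas_lemma Finset.univ a b (by
    intro w hw
    have hw₁ : ∀ i, Q.R₁ Y i = Q.r₁ i → Q.R₁ w i ≤ 0 := fun i hi => by
      have := hw (Sum.inl i) (Finset.mem_univ _)
      simpa [a, act, hi] using this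
    have hw₂ : ∀ k, Q.R₂ w k = 0 := fun k => by
      have h1 := hw (Sum.inr (Sum.inl k)) (Finset.mem_univ _)
      have h2 := hw (Sum.inr (Sum.inr k)) (Finset.mem_univ _)
      simp [a] at h1 h2
      linarith
    refine nonneg_of_eventually_quadratic (b := ∑ a, Q.B w a ^ 2) ?_
    -- Affinity replaces a constraint qualification: a direction in the linearized cone stays
    -- feasible for small `t`, by sign for active constraints and by strict slack for the others.
    have hfeas : ∀ᶠ t in 𝓝[>] (0 : ℝ), ∀ i, Q.R₁ (Y + t • w) i ≤ Q.r₁ i := by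
      refine eventually_all.2 fun i => ?_
      simp only [map_add, map_smul, Pi.add_apply, Pi.smul_apply, smul_eq_mul]
      rcases (hY.ineq i).eq_or_lt with hi | hi
      · filter_upwards [self_mem_nhdsWithin] with t ht
        have := mul_nonpos_of_nonneg_of_nonpos (le_of_lt ht) (hw₁ i hi)
        linarith
      · have h1 : Tendsto (fun t : ℝ => Q.R₁ Y i + t * Q.R₁ w i) (𝓝[>] 0) (𝓝 (Q.R₁ Y i)) := by
          have : Tendsto (fun t : ℝ => Q.R₁ Y i + t * Q.R₁ w i) (𝓝 0)
              (𝓝 (Q.R₁ Y i + 0 * Q.R₁ w i)) :=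
            (by fun_prop : Continuous fun t : ℝ => Q.R₁ Y i + t * Q.R₁ w i).tendsto 0
          rw [zero_mul, add_zero] at this
          exact this.mono_left nhdsWithin_le_nhds
        filter_upwards [h1.eventually_lt_const hi] with t ht using ht.le
    filter_upwards [hfeas] with t ht
    have h1 := hopt (Y + t • w) ⟨ht, fun k => by simp [hw₂ k, hY.eq k]⟩
    rw [← lag_zero, ← lag_zero, lag_add_smul] at h1
    show 0 ≤ t * Q.dlag Y 0 0 w + _
    linarith)
  -- The signs come from moving the conic combination to the other side of the stationarity
  -- equation.
  refine ⟨fun i => if act i then c (Sum.inl i) else 0,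
    fun k => c (Sum.inr (Sum.inr k)) - c (Sum.inr (Sum.inl k)), hY, fun i => ?_, fun i => ?_,
    fun v => ?_⟩
  · split_ifs
    · exact hc _
    · exact le_rfl
  · by_cases hi : act i
    · simp only [if_pos hi]; rw [show Q.R₁ Y i = Q.r₁ i from hi]; simp
    · simp [hi]
  · have h1 := hcb v
    change Q.dlag Y 0 0 v = _ at h1
    simp only [dlag, Pi.zero_apply, zero_mul, Finset.sum_const_zero, add_zero,
      Fintype.sum_sum_type, a, Sum.elim_inl, Sum.elim_inr, LinearMap.neg_apply,
      LinearMap.comp_apply, LinearMap.proj_apply] at h1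
    have h2 : ∑ i, c (Sum.inl i) * (if act i then -(LinearMap.proj i ∘ₗ Q.R₁) else 0 : E →ₗ[ℝ] ℝ) v
        = -∑ i, (if act i then c (Sum.inl i) else 0) * Q.R₁ v i := by
      rw [← Finset.sum_neg_distrib]
      refine Finset.sum_congr rfl fun i _ => ?_
      split_ifs <;> simp
    rw [h2] at h1
    have h3 : ∑ k, (c (Sum.inr (Sum.inr k)) - c (Sum.inr (Sum.inl k))) * Q.R₂ v k
        = ∑ k, c (Sum.inr (Sum.inr k)) * Q.R₂ v k - ∑ k, c (Sum.inr (Sum.inl k)) * Q.R₂ v k := by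
      simp only [sub_mul, Finset.sum_sub_distrib]
    simp only [dlag, h3]
    simp only [mul_neg, Finset.sum_neg_distrib] at h1
    linarith

/-- The saddle-point flow dissipates the distance to any KKT point. -/
theorem KKT.dissipation {Q : LeastSquaresProgram E ν ι κ} {Y₀ : E} {η₀ : ι → ℝ} {μ₀ : κ → ℝ}
    (h : Q.KKT Y₀ η₀ μ₀) (Y : E) (η : ι → ℝ) (μ : κ → ℝ) :
    -Q.dlag Y η μ (Y - Y₀) + ∑ i, (η i - η₀ i) * (Q.R₁ Y i - Q.r₁ i)
      + ∑ k, (μ k - μ₀ k) * (Q.R₂ Y k - Q.r₂ k)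
    = -(2 * ∑ a, Q.B (Y - Y₀) a ^ 2 + ∑ i, η i * (Q.r₁ i - Q.R₁ Y₀ i)) := by
  -- Subtracting stationarity of the KKT point in the direction `Y - Y₀` cancels all bilinear
  -- primal-dual terms; the quadratic part of the objective and the slackness remain.
  have h0 := h.stat (Y - Y₀)
  simp only [dlag] at h0 ⊢
  have e1 : ∑ a, (Q.B Y a - Q.r a) * Q.B (Y - Y₀) a
      = ∑ a, (Q.B Y₀ a - Q.r a) * Q.B (Y - Y₀) a + ∑ a, Q.B (Y - Y₀) a ^ 2 := by
    rw [← Finset.sum_add_distrib]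
    exact Finset.sum_congr rfl fun a _ => by simp only [map_sub, Pi.sub_apply]; ring
  have e2 : ∑ i, (η i - η₀ i) * (Q.R₁ Y i - Q.r₁ i)
      = ∑ i, η i * Q.R₁ (Y - Y₀) i - ∑ i, η₀ i * Q.R₁ (Y - Y₀) i
        - ∑ i, η i * (Q.r₁ i - Q.R₁ Y₀ i) := by
    rw [← Finset.sum_sub_distrib, ← Finset.sum_sub_distrib]
    refine Finset.sum_congr rfl fun i _ => ?_
    have := h.compl i
    simp only [map_sub, Pi.sub_apply]
    linear_combination -this
  have e3 : ∑ k, (μ k - μ₀ k) * (Q.R₂ Y k - Q.r₂ k)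
      = ∑ k, μ k * Q.R₂ (Y - Y₀) k - ∑ k, μ₀ k * Q.R₂ (Y - Y₀) k := by
    rw [← Finset.sum_sub_distrib]
    refine Finset.sum_congr rfl fun k _ => ?_
    simp only [map_sub, Pi.sub_apply, h.feas.eq k]
    ring
  rw [e1, e2, e3]
  linarith

end LeastSquaresProgram

/-! ### Strong convexity and existence of minimizers -/

namespace LeastSquaresProgram

variable {E ν ι κ : Type*} [NormedAddCommGroup E] [NormedSpace ℝ E] [FiniteDimensional ℝ E]
  [Fintype ν] [Fintype ι] [Fintype κ] (Q : LeastSquaresProgram E ν ι κ)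

-- An injective linear map on a finite-dimensional space is bounded below, and the sum of squares
-- dominates the squared sup norm of its values. The constant serves for strong convexity,
-- coercivity and the decay of the primal error.
omit [Fintype ι] [Fintype κ] in
theorem exists_mul_norm_sq_le (hB : Function.Injective Q.B) :
    ∃ m : ℝ, 0 < m ∧ ∀ v, m * ‖v‖ ^ 2 ≤ ∑ a, Q.B v a ^ 2 := by
  obtain ⟨K, hK, hKB⟩ := Q.B.exists_antilipschitzWith (LinearMap.ker_eq_bot.2 hB)
  have hK' : (0 : ℝ) < K := hK
  refine ⟨((K : ℝ) ^ 2)⁻¹, by positivity, fun v => ?_⟩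
  have h1 : ‖v‖ ≤ K * ‖Q.B v‖ := by simpa using hKB.le_mul_dist v 0
  have h2 : ‖Q.B v‖ ≤ √(∑ a, Q.B v a ^ 2) := by
    refine (pi_norm_le_iff_of_nonneg (Real.sqrt_nonneg _)).2 fun a => Real.abs_le_sqrt ?_
    exact Finset.single_le_sum (f := fun a => Q.B v a ^ 2) (fun _ _ => sq_nonneg _)
      (Finset.mem_univ a)
  have h3 : 0 ≤ ∑ a, Q.B v a ^ 2 := Finset.sum_nonneg fun _ _ => sq_nonneg _
  rw [inv_mul_le_iff₀ (by positivity)]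
  calc ‖v‖ ^ 2 ≤ (K * √(∑ a, Q.B v a ^ 2)) ^ 2 := by gcongr; exact h1.trans (by gcongr)
    _ = _ := by rw [mul_pow, Real.sq_sqrt h3]

-- The convexity defect of a sum of squares is exactly `s * t * ∑ a, Q.B (X - Y) a ^ 2`. The modulus
-- is `2 * m` because the definition of strong convexity halves it.
omit [FiniteDimensional ℝ E] [Fintype ι] [Fintype κ] in
theorem strongConvexOn_obj {m : ℝ} (hm : ∀ v, m * ‖v‖ ^ 2 ≤ ∑ a, Q.B v a ^ 2) :
    StrongConvexOn univ (2 * m) Q.obj := by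
  refine ⟨convex_univ, fun X _ Y _ s t hs ht hst => ?_⟩
  have h1 := hm (X - Y)
  have h2 : Q.obj (s • X + t • Y)
      = s * Q.obj X + t * Q.obj Y - s * t * ∑ a, Q.B (X - Y) a ^ 2 := by
    simp only [obj, Finset.mul_sum]
    rw [← Finset.sum_add_distrib, ← Finset.sum_sub_distrib]
    refine Finset.sum_congr rfl fun a _ => ?_
    obtain rfl : t = 1 - s := by linarith
    simp only [map_add, map_sub, map_smul, Pi.add_apply, Pi.sub_apply, Pi.smul_apply, smul_eq_mul]
    ring
  have h3 := mul_le_mul_of_nonneg_left h1 (mul_nonneg hs ht)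
  simp only [smul_eq_mul]
  rw [h2]
  linarith

omit [Fintype ι] [Fintype κ] in
theorem continuous_obj : Continuous Q.obj := by
  unfold obj
  have := Q.B.continuous_of_finiteDimensional
  fun_prop

omit [Fintype ν] [Fintype ι] [Fintype κ] in
theorem isClosed_feas : IsClosed {Y | Q.Feas Y} := by
  have h1 := Q.R₁.continuous_of_finiteDimensional
  have h2 := Q.R₂.continuous_of_finiteDimensional
  have : {Y | Q.Feas Y} = (⋂ i, {Y | Q.R₁ Y i ≤ Q.r₁ i}) ∩ ⋂ k, {Y | Q.R₂ Y k = Q.r₂ k} := by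
    ext Y
    simp only [mem_ofPred_eq, mem_inter_iff, mem_iInter]
    exact ⟨fun h => ⟨h.1, h.2⟩, fun h => ⟨h.1, h.2⟩⟩
  rw [this]
  exact (isClosed_iInter fun i => isClosed_le (by fun_prop) (by fun_prop)).inter
    (isClosed_iInter fun k => isClosed_eq (by fun_prop) (by fun_prop))

omit [Fintype ι] [Fintype κ] in
theorem exists_optimal (hB : Function.Injective Q.B) {Y₀ : E} (hY₀ : Q.Feas Y₀) :
    ∃ Y, Q.Feas Y ∧ ∀ Y', Q.Feas Y' → Q.obj Y ≤ Q.obj Y' := by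
  obtain ⟨m, hm, hmB⟩ := Q.exists_mul_norm_sq_le hB
  -- Coercivity: the inequality `b² ≤ 2 (b - r)² + 2 r²`, whose defect is `(b - 2 r)²`, bounds the
  -- objective below by half of `‖B Y‖²` up to a constant.
  have hlow : ∀ Y, m / 2 * ‖Y‖ ^ 2 + -∑ a, Q.r a ^ 2 ≤ Q.obj Y := by
    intro Y
    have h1 := hmB Y
    have h2 : ∑ a, Q.B Y a ^ 2 ≤ 2 * Q.obj Y + 2 * ∑ a, Q.r a ^ 2 := by
      rw [obj, Finset.mul_sum, Finset.mul_sum, ← Finset.sum_add_distrib]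
      exact Finset.sum_le_sum fun a _ => by nlinarith [sq_nonneg (Q.B Y a - 2 * Q.r a)]
    linarith
  have hlim : Tendsto (fun Y : E => m / 2 * ‖Y‖ ^ 2 + -∑ a, Q.r a ^ 2) (cocompact E) atTop :=
    tendsto_atTop_add_const_right _ _
      (((tendsto_pow_atTop two_ne_zero).comp tendsto_norm_cocompact_atTop).const_mul_atTop
        (half_pos hm))
  obtain ⟨Y, hY, hmin⟩ := Q.continuous_obj.continuousOn.exists_isMinOn' Q.isClosed_feas hY₀
    (Eventually.filter_mono inf_le_left <|
      (hlim.eventually_ge_atTop (Q.obj Y₀)).mono fun Y h => h.trans (hlow Y))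
  exact ⟨Y, hY, fun Y' hY' => hmin hY'⟩

end LeastSquaresProgram

/-! ### Convergence of the saddle-point flow -/

theorem MPCData.posProj_mul {c : ℝ} (hc : 0 < c) (a b : ℝ) :
    MPCData.posProj (c * a) b = c * MPCData.posProj a b := by
  unfold MPCData.posProj
  split_ifs
  · rfl
  · rw [mul_max_of_nonneg _ _ hc.le, mul_zero]

/-- Monotonicity of the projection: it only helps to approach points of the half-line. -/
theorem MPCData.mul_posProj_le {a b y : ℝ} (hb : 0 ≤ b) (hy : 0 ≤ y) :
    (b - y) * MPCData.posProj a b ≤ (b - y) * a := by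
  unfold MPCData.posProj
  split_ifs with h
  · exact le_rfl
  · obtain rfl : b = 0 := le_antisymm (not_lt.1 h) hb
    nlinarith [le_max_left a 0]

/-- Lyapunov stability of points from which the weighted distance does not increase. -/
theorem exists_forall_dist_lt {J : Type*} [Fintype J] {C : Set J} {f : (J → ℝ) → J → ℝ}
    {e y : J → ℝ} (he : ∀ j, 0 < e j)
    (hdiss : ∀ z : J → ℝ, (∀ j ∈ C, 0 ≤ z j) →
      ∑ j, e j * (z j - y j) * projField C f z j ≤ 0) {ρ : ℝ} (hρ : 0 < ρ) :
    ∃ δ > 0, ∀ x, IsProjTrajectory C f x → dist (x 0) y < δ → ∀ t, 0 ≤ t → dist (x t) y < ρ := by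
  obtain ⟨c, hc, hle⟩ := exists_mul_sq_dist_le_weightedSqDist he
  have h1 : ∀ᶠ z in 𝓝 y, weightedSqDist e y z < c * ρ ^ 2 :=
    (continuous_weightedSqDist e y).continuousAt.eventually_lt_const
      (by rw [weightedSqDist_self]; positivity)
  obtain ⟨δ, hδ, hball⟩ := Metric.eventually_nhds_iff.1 h1
  refine ⟨δ, hδ, fun x hx h0 t ht => ?_⟩
  have h2 := (hle y (x t)).trans_lt
    ((hx.weightedSqDist_le hdiss le_rfl ht).trans_lt (hball h0))
  exact lt_of_pow_lt_pow_left₀ 2 hρ.le (lt_of_mul_lt_mul_left h2 hc.le)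

namespace LeastSquaresProgram

variable {n ν ι κ : Type*} [Fintype n] [DecidableEq n] [Fintype ν] [Fintype ι] [Fintype κ]

/-- The primal component of a vector of primal and dual variables. -/
noncomputable def primalPart : (n ⊕ ι ⊕ κ → ℝ) →ₗ[ℝ] EuclideanSpace ℝ n :=
  (WithLp.linearEquiv 2 ℝ (n → ℝ)).symm.toLinearMap ∘ₗ LinearMap.funLeft ℝ ℝ Sum.inl

/-- The multipliers of the inequality constraints. -/
abbrev ineqPart (z : n ⊕ ι ⊕ κ → ℝ) (i : ι) : ℝ := z (Sum.inr (Sum.inl i))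

/-- The multipliers of the equality constraints. -/
abbrev eqPart (z : n ⊕ ι ⊕ κ → ℝ) (k : κ) : ℝ := z (Sum.inr (Sum.inr k))

/-- The vector field of the saddle-point flow, before projection. -/
noncomputable def flowField (Q : LeastSquaresProgram (EuclideanSpace ℝ n) ν ι κ) (εZ εη εμ : ℝ)
    (z : n ⊕ ι ⊕ κ → ℝ) : n ⊕ ι ⊕ κ → ℝ
  | Sum.inl a => εZ⁻¹ * -Q.dlag (primalPart z) (ineqPart z) (eqPart z) (EuclideanSpace.single a 1)
  | Sum.inr (Sum.inl i) => εη⁻¹ * (Q.R₁ (primalPart z) i - Q.r₁ i)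
  | Sum.inr (Sum.inr k) => εμ⁻¹ * (Q.R₂ (primalPart z) k - Q.r₂ k)

/-- The coordinates holding multipliers of inequality constraints. -/
def ineqCoords (n ι κ : Type*) : Set (n ⊕ ι ⊕ κ) := range (Sum.inr ∘ Sum.inl)

/-- Time scales of the saddle-point flow. -/
def timeScales (n ι κ : Type*) (εZ εη εμ : ℝ) : n ⊕ ι ⊕ κ → ℝ :=
  Sum.elim (fun _ => εZ) (Sum.elim (fun _ => εη) (fun _ => εμ))

omit [Fintype n] [DecidableEq n] [Fintype ι] [Fintype κ] in
theorem timeScales_pos {εZ εη εμ : ℝ} (hZ : 0 < εZ) (hη : 0 < εη) (hμ : 0 < εμ) (j : n ⊕ ι ⊕ κ) :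
    0 < timeScales n ι κ εZ εη εμ j := by
  rcases j with a | i | k <;> assumption

variable (Q : LeastSquaresProgram (EuclideanSpace ℝ n) ν ι κ) {εZ εη εμ : ℝ}

/-- Before projection every component is affine, because the Lagrangian is quadratic in the primal
variable and affine in the multipliers with affine constraints; hence the global Lipschitz bound. -/
theorem exists_lipschitzWith_flowField (εZ εη εμ : ℝ) :
    ∃ K, LipschitzWith K (Q.flowField εZ εη εμ) := by
  have key : ∀ j, ∃ (l : (n ⊕ ι ⊕ κ → ℝ) →ₗ[ℝ] ℝ) (c : ℝ),
      ∀ z, Q.flowField εZ εη εμ z j = l z + c := by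
    rintro (a | i | k)
    · set v : EuclideanSpace ℝ n := EuclideanSpace.single a 1
      refine ⟨-εZ⁻¹ • ((2 : ℝ) • ∑ b, Q.B v b • (LinearMap.proj b ∘ₗ Q.B ∘ₗ primalPart)
        + ∑ i, Q.R₁ v i • LinearMap.proj (Sum.inr (Sum.inl i))
        + ∑ k, Q.R₂ v k • LinearMap.proj (Sum.inr (Sum.inr k))),
        εZ⁻¹ * (2 * ∑ b, Q.r b * Q.B v b), fun z => ?_⟩
      simp only [flowField, dlag, LinearMap.smul_apply, LinearMap.add_apply, LinearMap.sum_apply,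
        LinearMap.comp_apply, LinearMap.proj_apply, smul_eq_mul, sub_mul, Finset.sum_sub_distrib]
      simp only [mul_comm (Q.B v _), mul_comm (Q.R₁ v _), mul_comm (Q.R₂ v _)]
      ring
    · exact ⟨εη⁻¹ • (LinearMap.proj i ∘ₗ Q.R₁ ∘ₗ primalPart), -(εη⁻¹ * Q.r₁ i),
        fun z => by simp only [flowField, LinearMap.smul_apply, LinearMap.comp_apply,
          LinearMap.proj_apply, smul_eq_mul]; ring⟩
    · exact ⟨εμ⁻¹ • (LinearMap.proj k ∘ₗ Q.R₂ ∘ₗ primalPart), -(εμ⁻¹ * Q.r₂ k),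
        fun z => by simp only [flowField, LinearMap.smul_apply, LinearMap.comp_apply,
          LinearMap.proj_apply, smul_eq_mul]; ring⟩
  choose l c hlc using key
  let Λ : (n ⊕ ι ⊕ κ → ℝ) →L[ℝ] (n ⊕ ι ⊕ κ → ℝ) := (LinearMap.pi l).toContinuousLinearMap
  refine ⟨‖Λ‖₊, LipschitzWith.of_dist_le_mul fun u v => ?_⟩
  have h : ∀ z, Q.flowField εZ εη εμ z = Λ z + c := fun z => by ext j; exact hlc j z
  rw [h, h, dist_add_right]
  exact Λ.lipschitz.dist_le_mul u v

omit [Fintype n] [DecidableEq n] in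
theorem dlag_add (Y : EuclideanSpace ℝ n) (η : ι → ℝ) (μ : κ → ℝ) (u v : EuclideanSpace ℝ n) :
    Q.dlag Y η μ (u + v) = Q.dlag Y η μ u + Q.dlag Y η μ v := by
  simp only [dlag, map_add, Pi.add_apply, mul_add, Finset.sum_add_distrib]
  ring

theorem dlag_eq_sum (Y : EuclideanSpace ℝ n) (η : ι → ℝ) (μ : κ → ℝ) (v : EuclideanSpace ℝ n) :
    Q.dlag Y η μ v = ∑ a, v a * Q.dlag Y η μ (EuclideanSpace.single a 1) := by
  let D : EuclideanSpace ℝ n →ₗ[ℝ] ℝ :=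
    { toFun := Q.dlag Y η μ
      map_add' := Q.dlag_add Y η μ
      map_smul' := fun t v => Q.dlag_smul Y v η μ t }
  have h : v = ∑ a, v a • EuclideanSpace.single a (1 : ℝ) := by
    ext b
    simp [Finset.sum_apply, Pi.single_apply]
  change D v = ∑ a, v a * D _
  conv_lhs => rw [h]
  simp [map_sum]

/-- The dissipation rate of the saddle-point flow relative to a KKT point with primal part `Y₀`. -/
noncomputable def dissipationRate (Y₀ : EuclideanSpace ℝ n) (z : n ⊕ ι ⊕ κ → ℝ) : ℝ :=
  2 * ∑ a, Q.B (primalPart z - Y₀) a ^ 2 + ∑ i, ineqPart z i * (Q.r₁ i - Q.R₁ Y₀ i)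

omit [Fintype κ] [DecidableEq n] in
theorem continuous_primalPart [Finite κ] :
    Continuous (primalPart : (n ⊕ ι ⊕ κ → ℝ) → EuclideanSpace ℝ n) := by
  cases nonempty_fintype κ
  exact LinearMap.continuous_of_finiteDimensional _

omit [DecidableEq n] in
theorem continuous_dissipationRate (Y₀ : EuclideanSpace ℝ n) :
    Continuous (Q.dissipationRate Y₀) := by
  have h1 : Continuous (primalPart : (n ⊕ ι ⊕ κ → ℝ) → EuclideanSpace ℝ n) := continuous_primalPart
  have h2 := Q.B.continuous_of_finiteDimensional
  unfold dissipationRate ineqPart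
  fun_prop

omit [DecidableEq n] [Fintype n] [Fintype κ] in
theorem dissipationRate_nonneg {Y₀ : EuclideanSpace ℝ n} (hY₀ : Q.Feas Y₀)
    {z : n ⊕ ι ⊕ κ → ℝ} (hz : ∀ j ∈ ineqCoords n ι κ, 0 ≤ z j) : 0 ≤ Q.dissipationRate Y₀ z :=
  add_nonneg (mul_nonneg zero_le_two (Finset.sum_nonneg fun _ _ => sq_nonneg _))
    (Finset.sum_nonneg fun i _ =>
      mul_nonneg (hz _ ⟨i, rfl⟩) (sub_nonneg.2 (hY₀.ineq i)))

/-- Weighting by the time scales cancels their inverses in the field, which leaves the identity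
`KKT.dissipation`. The projection only improves on it, since the reference multiplier is
nonnegative. -/
theorem flow_dissipation (hZ : 0 < εZ) (hη : 0 < εη) (hμ : 0 < εμ) {y : n ⊕ ι ⊕ κ → ℝ}
    (hy : Q.KKT (primalPart y) (ineqPart y) (eqPart y))
    {z : n ⊕ ι ⊕ κ → ℝ} (hz : ∀ j ∈ ineqCoords n ι κ, 0 ≤ z j) :
    ∑ j, timeScales n ι κ εZ εη εμ j * (z j - y j) *
        projField (ineqCoords n ι κ) (Q.flowField εZ εη εμ) z j
      ≤ -Q.dissipationRate (primalPart y) z := by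
  rw [dissipationRate, ← hy.dissipation, Fintype.sum_sum_type, Fintype.sum_sum_type, ← add_assoc]
  refine add_le_add (add_le_add (le_of_eq ?_) (Finset.sum_le_sum fun i _ => ?_)) (le_of_eq ?_)
  · rw [dlag_eq_sum, ← Finset.sum_neg_distrib]
    refine Finset.sum_congr rfl fun a _ => ?_
    have : (Sum.inl a : n ⊕ ι ⊕ κ) ∉ ineqCoords n ι κ := by simp [ineqCoords]
    simp only [projField, this, if_false, timeScales, Sum.elim_inl, flowField]
    rw [show (primalPart z - primalPart y) a = z (Sum.inl a) - y (Sum.inl a) from rfl]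
    field_simp
  · have : (Sum.inr (Sum.inl i) : n ⊕ ι ⊕ κ) ∈ ineqCoords n ι κ := ⟨i, rfl⟩
    simp only [projField, this, if_true, timeScales, Sum.elim_inl, Sum.elim_inr, flowField]
    -- The time scale sits inside the projection and is pulled out by positive homogeneity.
    rw [MPCData.posProj_mul (inv_pos.2 hη)]
    refine le_trans (le_of_eq ?_) (MPCData.mul_posProj_le (hz _ this) (hy.nonneg i))
    field_simp
  · refine Finset.sum_congr rfl fun k _ => ?_
    have : (Sum.inr (Sum.inr k) : n ⊕ ι ⊕ κ) ∉ ineqCoords n ι κ := by simp [ineqCoords]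
    simp only [projField, this, if_false, timeScales, Sum.elim_inr, flowField]
    field_simp

theorem flow_dissipation_nonpos (hZ : 0 < εZ) (hη : 0 < εη) (hμ : 0 < εμ) {y : n ⊕ ι ⊕ κ → ℝ}
    (hy : Q.KKT (primalPart y) (ineqPart y) (eqPart y))
    {z : n ⊕ ι ⊕ κ → ℝ} (hz : ∀ j ∈ ineqCoords n ι κ, 0 ≤ z j) :
    ∑ j, timeScales n ι κ εZ εη εμ j * (z j - y j) *
        projField (ineqCoords n ι κ) (Q.flowField εZ εη εμ) z j ≤ 0 :=
  (Q.flow_dissipation hZ hη hμ hy hz).trans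
    (neg_nonpos.2 (Q.dissipationRate_nonneg hy.feas hz))

/-- Every trajectory of the saddle-point flow of a least squares program with injective `B`
converges to a KKT point. -/
theorem exists_tendsto_of_trajectory (hB : Function.Injective Q.B)
    (hZ : 0 < εZ) (hη : 0 < εη) (hμ : 0 < εμ) {y : n ⊕ ι ⊕ κ → ℝ}
    (hy : Q.KKT (primalPart y) (ineqPart y) (eqPart y)) {x : ℝ → n ⊕ ι ⊕ κ → ℝ}
    (hx : IsProjTrajectory (ineqCoords n ι κ) (Q.flowField εZ εη εμ) x) :
    ∃ z, primalPart z = primalPart y ∧ Q.KKT (primalPart z) (ineqPart z) (eqPart z) ∧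
      Tendsto x atTop (𝓝 z) := by
  have hpos := timeScales_pos (n := n) (ι := ι) (κ := κ) hZ hη hμ
  obtain ⟨K, hK⟩ := Q.exists_lipschitzWith_flowField εZ εη εμ
  have hf := hK.continuous
  have hcont := Q.continuous_dissipationRate (κ := κ) (primalPart y)
  obtain ⟨R, hR⟩ := hx.exists_norm_le hpos fun z hz => Q.flow_dissipation_nonpos hZ hη hμ hy hz
  have hφ := hx.tendsto_dissipation hf hpos hcont
    (fun z hz => Q.dissipationRate_nonneg hy.feas hz)
    (fun z hz => Q.flow_dissipation hZ hη hμ hy hz)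
  obtain ⟨m, hm, hmB⟩ := Q.exists_mul_norm_sq_le hB
  have hle : ∀ z : n ⊕ ι ⊕ κ → ℝ, (∀ j ∈ ineqCoords n ι κ, 0 ≤ z j) →
      2 * m * ‖primalPart z - primalPart y‖ ^ 2 ≤ Q.dissipationRate (primalPart y) z := by
    intro z hz
    have h1 := hmB (primalPart z - primalPart y)
    have h2 : 0 ≤ ∑ i, ineqPart z i * (Q.r₁ i - Q.R₁ (primalPart y) i) :=
      Finset.sum_nonneg fun i _ => mul_nonneg (hz _ ⟨i, rfl⟩) (sub_nonneg.2 (hy.feas.ineq i))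
    unfold dissipationRate
    linarith
  have hprimal : ∀ a, Tendsto (fun t => x t (Sum.inl a)) atTop (𝓝 (y (Sum.inl a))) := by
    intro a
    rw [tendsto_iff_dist_tendsto_zero]
    have h1 : Tendsto (fun t => √(Q.dissipationRate (primalPart y) (x t) / (2 * m))) atTop
        (𝓝 0) := by
      simpa using (hφ.div_const (2 * m)).sqrt
    refine tendsto_of_tendsto_of_tendsto_of_le_of_le' tendsto_const_nhds h1
      (Eventually.of_forall fun _ => dist_nonneg) ?_
    filter_upwards [eventually_ge_atTop 0] with t ht
    refine Real.le_sqrt_of_sq_le ?_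
    rw [le_div_iff₀ (by positivity), mul_comm]
    refine le_trans ?_ (hle (x t) fun j hj => hx.nonneg hj ht)
    have := PiLp.norm_apply_le (primalPart (x t) - primalPart y) a
    rw [dist_eq_norm]
    gcongr
    exact this
  -- Primal coordinates are not projected and they converge, so their velocities tend to zero. This
  -- is what makes cluster points stationary.
  have hstat : ∀ a, Tendsto (fun t => Q.flowField εZ εη εμ (x t) (Sum.inl a)) atTop (𝓝 0) :=
    fun a => hx.tendsto_field_of_tendsto hf hR (by simp [ineqCoords]) (hprimal a)
  have hcpt : IsCompact (Metric.closedBall y R ∩ {z | ∀ j ∈ ineqCoords n ι κ, 0 ≤ z j}) := by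
    refine (isCompact_closedBall y R).inter_right ?_
    have : {z : n ⊕ ι ⊕ κ → ℝ | ∀ j ∈ ineqCoords n ι κ, 0 ≤ z j}
        = ⋂ j ∈ ineqCoords n ι κ, {z | 0 ≤ z j} := by ext; simp
    rw [this]
    exact isClosed_biInter fun j _ => isClosed_le continuous_const (continuous_apply j)
  obtain ⟨z, ⟨-, hz0⟩, hz⟩ := hcpt.exists_mapClusterPt (f := atTop) (u := x)
    (tendsto_principal.2 ((eventually_ge_atTop 0).mono fun t ht =>
      ⟨hR t ht, fun j hj => hx.nonneg hj ht⟩))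
  have hzφ : Q.dissipationRate (primalPart y) z = 0 := hz.eq_of_tendsto hcont.continuousAt hφ
  have hzY : primalPart z = primalPart y := by
    have h1 := hle z hz0
    rw [hzφ] at h1
    have h2 : ‖primalPart z - primalPart y‖ ^ 2 ≤ 0 := by
      by_contra! h3
      have := mul_pos (mul_pos two_pos hm) h3
      linarith
    exact sub_eq_zero.1 (norm_eq_zero.1 (pow_eq_zero_iff two_ne_zero |>.1
      (le_antisymm h2 (sq_nonneg _))))
  have hkkt : Q.KKT (primalPart z) (ineqPart z) (eqPart z) := by
    refine ⟨hzY ▸ hy.feas, fun i => hz0 _ ⟨i, rfl⟩, ?_, fun v => ?_⟩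
    -- The dissipation rate vanishes at the cluster point; its slackness sum has nonnegative terms,
    -- so each of them vanishes.
    · have h0 : ∀ i ∈ Finset.univ, 0 ≤ ineqPart z i * (Q.r₁ i - Q.R₁ (primalPart y) i) := fun i _ =>
        mul_nonneg (hz0 _ ⟨i, rfl⟩) (sub_nonneg.2 (hy.feas.ineq i))
      have h1 : ∑ i, ineqPart z i * (Q.r₁ i - Q.R₁ (primalPart y) i) = 0 := by
        rw [dissipationRate, hzY] at hzφ
        simpa using hzφ
      rw [Finset.sum_eq_zero_iff_of_nonneg h0] at h1
      intro i
      have h2 := h1 i (Finset.mem_univ i)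
      rw [hzY]
      linear_combination -h2
    · rw [dlag_eq_sum]
      refine Finset.sum_eq_zero fun a _ => ?_
      have h1 : Q.flowField εZ εη εμ z (Sum.inl a) = 0 :=
        hz.eq_of_tendsto (ψ := fun z => Q.flowField εZ εη εμ z (Sum.inl a))
          ((continuous_apply (Sum.inl a)).comp hf).continuousAt (hstat a)
      simp only [flowField, mul_eq_zero, inv_eq_zero, hZ.ne', neg_eq_zero, false_or] at h1
      rw [h1, mul_zero]
  -- The dissipation inequality is now used relative to the cluster point itself instead of `y`.
  exact ⟨z, hzY, hkkt, hx.tendsto_of_mapClusterPt hpos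
    (fun w hw => Q.flow_dissipation_nonpos hZ hη hμ hkkt hw) hz⟩

end LeastSquaresProgram

/-! ### The gradient of the Lagrangian -/

theorem LinearMap.differentiable_apply {E m : Type*} [NormedAddCommGroup E] [NormedSpace ℝ E]
    [FiniteDimensional ℝ E] (l : E →ₗ[ℝ] m → ℝ) (a : m) : Differentiable ℝ fun Y => l Y a :=
  (LinearMap.toContinuousLinearMap ((LinearMap.proj a : (m → ℝ) →ₗ[ℝ] ℝ) ∘ₗ l)).differentiable

namespace LeastSquaresProgram

variable {n ν ι κ : Type*} [Fintype n] [DecidableEq n] [Fintype ν] [Fintype ι] [Fintype κ]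
  (Q : LeastSquaresProgram (EuclideanSpace ℝ n) ν ι κ)

omit [DecidableEq n] in
theorem differentiable_lag (η : ι → ℝ) (μ : κ → ℝ) :
    Differentiable ℝ fun Y => Q.lag Y η μ := by
  have h1 := Q.B.differentiable_apply
  have h2 := Q.R₁.differentiable_apply
  have h3 := Q.R₂.differentiable_apply
  unfold lag obj
  fun_prop

omit [Fintype n] [DecidableEq n] in
theorem lineDeriv_lag (Y v : EuclideanSpace ℝ n) (η : ι → ℝ) (μ : κ → ℝ) :
    lineDeriv ℝ (fun Z => Q.lag Z η μ) Y v = Q.dlag Y η μ v := by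
  simp only [lineDeriv, lag_add_smul]
  have h := ((((hasDerivAt_id' (0 : ℝ)).mul_const (Q.dlag Y η μ v)).add
    ((hasDerivAt_pow 2 (0 : ℝ)).mul_const (∑ a, Q.B v a ^ 2))).const_add (Q.lag Y η μ)).deriv
  simpa using h

end LeastSquaresProgram

/-- Line derivatives are accessible both from the quadratic expansion of the Lagrangian and from the
locality of its increments. -/
theorem gradient_apply_eq_lineDeriv {n : Type*} [Fintype n] [DecidableEq n]
    {f : EuclideanSpace ℝ n → ℝ} {Y : EuclideanSpace ℝ n} (hf : DifferentiableAt ℝ f Y) (i : n) :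
    gradient f Y i = lineDeriv ℝ f Y (EuclideanSpace.single i 1) := by
  rw [hf.lineDeriv_eq_fderiv]
  have h := InnerProductSpace.toDual_symm_apply (𝕜 := ℝ) (x := EuclideanSpace.single i (1 : ℝ))
    (y := fderiv ℝ f Y)
  rw [← h, EuclideanSpace.inner_single_right]
  simp [gradient]

/-! ### The control problem as a least squares program -/

namespace MPCData

open PowerNetwork

variable {V : Type*} [Fintype V] [DecidableEq V] {G : SimpleGraph V}
  [DecidableRel G.Adj] {P : PowerNetwork G} {L : ℕ} (Q : MPCData P L)

/-- Indices of the squared terms of the objective function. -/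
abbrev CostIdx (P : PowerNetwork G) (L : ℕ) :=
  (Fin L × StateIdx G) ⊕ (Fin (L + 1) × V) ⊕ (Fin (L + 1) × {i // i ∈ P.Iω}) ⊕ StateIdx G

omit [DecidableRel G.Adj] in
theorem state_add (Y Y' : Primal P L) (k : Fin (L + 1)) :
    state (Y + Y') k = state Y k + state Y' k := rfl

omit [DecidableRel G.Adj] in
theorem state_smul (t : ℝ) (Y : Primal P L) (k : Fin (L + 1)) :
    state (t • Y) k = t • state Y k := rfl

omit [DecidableRel G.Adj] in
theorem input_add (Y Y' : Primal P L) : input (Y + Y') = input Y + input Y' := rfl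

omit [DecidableRel G.Adj] in
theorem input_smul (t : ℝ) (Y : Primal P L) : input (t • Y) = t • input Y := rfl

/-- The linear part of the model residual. -/
noncomputable def modelLin : Primal P L →ₗ[ℝ] Fin L × StateIdx G → ℝ where
  toFun Y p := (Q.F *ᵥ state Y p.1.succ - Q.A *ᵥ state Y p.1.castSucc - Q.B₂ *ᵥ input Y) p.2
  map_add' Y Y' := by
    ext p
    simp only [state_add, input_add, Matrix.mulVec_add, Pi.add_apply, Pi.sub_apply]
    ring
  map_smul' t Y := by
    ext p
    simp only [state_smul, input_smul, Matrix.mulVec_smul, Pi.smul_apply, Pi.sub_apply,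
      RingHom.id_apply, smul_eq_mul]
    ring

/-- The optimization problem as a linear least squares problem with affine constraints. -/
noncomputable def program :
    LeastSquaresProgram (Primal P L) (CostIdx P L) (IneqIdx P L) (EqIdx P L) where
  B :=
    { toFun := fun Y a => match a with
        | Sum.inl p => Q.modelLin Y p
        -- Costs enter through their square roots so that the objective is a single sum of squares.
        | Sum.inr (Sum.inl (k, i)) => √(P.c i) * filt Y k i
        | Sum.inr (Sum.inr (Sum.inl (k, i))) => √(P.d i) * slack Y k i
        | Sum.inr (Sum.inr (Sum.inr j)) => state Y 0 j
      map_add' := fun Y Y' => by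
        ext a
        rcases a with p | ⟨k, i⟩ | ⟨k, i⟩ | j
        · simp only [map_add, Pi.add_apply]
        · exact mul_add _ (filt Y k i) (filt Y' k i)
        · exact mul_add _ (slack Y k i) (slack Y' k i)
        · rfl
      map_smul' := fun t Y => by
        ext a
        rcases a with p | ⟨k, i⟩ | ⟨k, i⟩ | j
        · simp only [map_smul, Pi.smul_apply, RingHom.id_apply]
        · exact mul_left_comm _ t (filt Y k i)
        · exact mul_left_comm _ t (slack Y k i)
        · rfl }
  r a := match a with
    | Sum.inl (k, j) => (Q.B₁ *ᵥ Q.pf k.castSucc) j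
    | Sum.inr (Sum.inr (Sum.inr j)) => Q.x₀ j
    | _ => 0
  R₁ :=
    { toFun := fun Y a => match a with
        | Sum.inl (k, i, true) => freq Y k i - slack Y k i
        | Sum.inl (k, i, false) => -slack Y k i - freq Y k i
        | Sum.inr (i, true) => input Y i
        | Sum.inr (i, false) => -input Y i
      map_add' := fun Y Y' => by
        ext a
        rcases a with ⟨k, i, _ | _⟩ | ⟨i, _ | _⟩ <;>
          simp only [freq, slack, input, state, PiLp.add_apply, Pi.add_apply] <;> ring
      map_smul' := fun t Y => by
        ext a
        rcases a with ⟨k, i, _ | _⟩ | ⟨i, _ | _⟩ <;>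
          simp only [freq, slack, input, state, PiLp.smul_apply, Pi.smul_apply, smul_eq_mul,
            RingHom.id_apply] <;> ring }
  r₁ a := match a with
    | Sum.inl (_, i, true) => P.ωhi i
    | Sum.inl (_, i, false) => -P.ωlo i
    | Sum.inr (i, _) => P.ε i * |Q.filt₀ i|
  R₂ :=
    { toFun := fun Y a => match a with
        | Sum.inl p => Q.modelLin Y p
        | Sum.inr (Sum.inl j) => state Y 0 j
        | Sum.inr (Sum.inr i) => input Y i
      map_add' := fun Y Y' => by
        ext a
        rcases a with p | j | i
        · simp only [map_add, Pi.add_apply]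
        · rfl
        · rfl
      map_smul' := fun t Y => by
        ext a
        rcases a with p | j | i
        · simp only [map_smul, Pi.smul_apply, RingHom.id_apply]
        · rfl
        · rfl }
  r₂ a := match a with
    | Sum.inl (k, j) => (Q.B₁ *ᵥ Q.pf k.castSucc) j
    | Sum.inr (Sum.inl j) => Q.x₀ j
    | Sum.inr (Sum.inr _) => 0

theorem modelResidual_eq (Y : Primal P L) (k : Fin L) (j : StateIdx G) :
    Q.modelResidual Y k j = Q.modelLin Y (k, j) - (Q.B₁ *ᵥ Q.pf k.castSucc) j := by
  simp only [modelResidual, modelLin, LinearMap.coe_mk, AddHom.coe_mk, Pi.sub_apply]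
  ring

theorem ineqMap_eq (Y : Primal P L) (a : IneqIdx P L) :
    Q.ineqMap Y a = Q.program.R₁ Y a - Q.program.r₁ a := by
  rcases a with ⟨k, i, _ | _⟩ | ⟨i, _ | _⟩ <;> simp only [ineqMap, program, LinearMap.coe_mk,
    AddHom.coe_mk]
  ring

theorem eqMap_eq (Y : Primal P L) (a : EqIdx P L) :
    Q.eqMap Y a = Q.program.R₂ Y a - Q.program.r₂ a := by
  rcases a with ⟨k, j⟩ | j | i
  · exact Q.modelResidual_eq Y k j
  · rfl
  · exact (sub_zero _).symm

theorem gAug_eq (Y : Primal P L) : Q.gAug Y = Q.program.obj Y := by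
  simp only [gAug, LeastSquaresProgram.obj, Fintype.sum_sum_type, Fintype.sum_prod_type,
    modelResidual_eq, Finset.sum_add_distrib, program, LinearMap.coe_mk, AddHom.coe_mk, sub_zero,
    mul_pow]
  have h1 : ∀ i, √(P.c i) ^ 2 = P.c i := fun i => Real.sq_sqrt (P.c_pos i).le
  have h2 : ∀ i : {i // i ∈ P.Iω}, √(P.d i) ^ 2 = P.d i := fun i =>
    Real.sq_sqrt (P.d_pos i i.2).le
  simp only [h1, h2]
  ring

theorem lagrangian_eq (Y : Primal P L) (η : IneqDual P L) (μ : EqDual P L) :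
    Q.lagrangian Y η μ = Q.program.lag Y η μ := by
  simp only [lagrangian, LeastSquaresProgram.lag, gAug_eq, ineqMap_eq, eqMap_eq]

theorem feasible_iff (Y : Primal P L) : Q.Feasible Y ↔ Q.program.Feas Y := by
  constructor
  · intro h
    refine ⟨fun a => ?_, fun a => ?_⟩
    · rw [← sub_nonpos, ← ineqMap_eq]
      rcases a with ⟨k, i, _ | _⟩ | ⟨i, _ | _⟩
      · have := h.lower k i
        simp only [ineqMap]; linarith
      · have := h.upper k i
        simp only [ineqMap]; linarith
      · have := (abs_le.1 (h.sens i i.2)).1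
        simp only [ineqMap]; linarith
      · have := (abs_le.1 (h.sens i i.2)).2
        simp only [ineqMap]; linarith
    · rw [← sub_eq_zero, ← eqMap_eq]
      rcases a with ⟨k, j⟩ | j | i
      · have := congrFun (h.model k) j
        simp only [eqMap, modelResidual, Pi.sub_apply, Pi.add_apply] at this ⊢
        linarith
      · simp only [eqMap, h.init, sub_self]
      · exact h.location i i.2
  · intro h
    have h1 : ∀ a, Q.ineqMap Y a ≤ 0 := fun a => by
      rw [ineqMap_eq]; exact sub_nonpos.2 (h.ineq a)
    have h2 : ∀ a, Q.eqMap Y a = 0 := fun a => by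
      rw [eqMap_eq]; exact sub_eq_zero.2 (h.eq a)
    refine ⟨fun k => funext fun j => ?_, fun i hi => h2 (Sum.inr (Sum.inr ⟨i, hi⟩)),
      funext fun j => sub_eq_zero.1 (h2 (Sum.inr (Sum.inl j))), fun k i => ?_, fun k i => ?_,
      fun i hi => abs_le.2 ⟨?_, ?_⟩⟩
    · have := h2 (Sum.inl (k, j))
      simp only [eqMap, modelResidual, Pi.sub_apply, Pi.add_apply] at this ⊢
      linarith
    · have := h1 (Sum.inl (k, i, false))
      simp only [ineqMap] at this; linarith
    · have := h1 (Sum.inl (k, i, true))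
      simp only [ineqMap] at this; linarith
    · have := h1 (Sum.inr (⟨i, hi⟩, false))
      simp only [ineqMap] at this; linarith
    · have := h1 (Sum.inr (⟨i, hi⟩, true))
      simp only [ineqMap] at this; linarith

theorem differentiable_lagrangian (η : IneqDual P L) (μ : EqDual P L) :
    Differentiable ℝ fun Z => Q.lagrangian Z η μ := by
  simp only [lagrangian_eq]
  exact Q.program.differentiable_lag _ _

theorem primalField_eq_lineDeriv (x : PD P L) (i : PrimalIdx P L) :
    Q.primalField x i
      = -lineDeriv ℝ (fun Z => Q.lagrangian Z x.2.1 x.2.2) x.1 (EuclideanSpace.single i 1) := by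
  rw [primalField, gradient_apply_eq_lineDeriv (Q.differentiable_lagrangian _ _ _)]

theorem primalField_eq (x : PD P L) (i : PrimalIdx P L) :
    Q.primalField x i = -Q.program.dlag x.1 x.2.1 x.2.2 (EuclideanSpace.single i 1) := by
  rw [primalField_eq_lineDeriv]
  simp only [lagrangian_eq]
  rw [LeastSquaresProgram.lineDeriv_lag]

theorem isSaddle_iff (x : PD P L) : Q.IsSaddle x ↔ Q.program.KKT x.1 x.2.1 x.2.2 := by
  rw [LeastSquaresProgram.kkt_iff_saddle]
  simp only [IsSaddle, lagrangian_eq]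
  refine and_congr_right fun _ => and_congr_left fun _ => ⟨fun h η' μ' hη' => ?_,
    fun h η' μ' hη' => h _ _ hη'⟩
  exact h (WithLp.toLp 2 η') (WithLp.toLp 2 μ') hη'

end MPCData

/-! ### Energy argument, invertibility of `F` and feasibility -/

namespace MPCData

open PowerNetwork

variable {V : Type*} [Fintype V] [DecidableEq V] {G : SimpleGraph V}
  [DecidableRel G.Adj] {P : PowerNetwork G} {L : ℕ} (Q : MPCData P L)

theorem F_mulVec_line (x : StateIdx G → ℝ) (e : G.edgeSet) :
    (Q.F *ᵥ x) (Sum.inl e)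
      = x (Sum.inl e) - Q.T * (P.incidence *ᵥ fun i => x (Sum.inr (Sum.inl i))) e := by
  simp [F, Matrix.sub_mulVec, Matrix.smul_mulVec, Gt, At, Matrix.mulVec_diagonal, inertiaDiag,
    Matrix.fromBlocks_mulVec, Matrix.fromCols_mulVec, Function.comp_def]

theorem F_mulVec_freq (x : StateIdx G → ℝ) (i : V) :
    (Q.F *ᵥ x) (Sum.inr (Sum.inl i))
      = (P.M i + Q.T * P.E i) * x (Sum.inr (Sum.inl i))
        + Q.T * (P.incidenceᵀ *ᵥ fun e => P.b e * x (Sum.inl e)) i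
        - Q.T * x (Sum.inr (Sum.inr i)) := by
  have h : Matrix.diagonal P.b *ᵥ (fun e => x (Sum.inl e)) = fun e => P.b e * x (Sum.inl e) := by
    ext e; simp [Matrix.mulVec_diagonal]
  simp [F, Matrix.sub_mulVec, Matrix.smul_mulVec, Gt, At, Matrix.mulVec_diagonal, inertiaDiag,
    Matrix.fromBlocks_mulVec, Matrix.fromRows_mulVec, Function.comp_def, Matrix.neg_mulVec,
    ← Matrix.mulVec_mulVec, h]
  ring

theorem F_mulVec_filt (x : StateIdx G → ℝ) (i : V) :
    (Q.F *ᵥ x) (Sum.inr (Sum.inr i))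
      = if i ∈ P.Iu then (P.M i + Q.T * (1 / P.τ i)) * x (Sum.inr (Sum.inr i))
          + Q.T * x (Sum.inr (Sum.inl i))
        else Q.T * x (Sum.inr (Sum.inr i)) := by
  simp [F, Matrix.sub_mulVec, Matrix.smul_mulVec, Gt, At, Matrix.mulVec_diagonal, inertiaDiag,
    Matrix.fromBlocks_mulVec, Matrix.fromRows_mulVec, Function.comp_def, Matrix.neg_mulVec]
  split_ifs <;> ring

/-- The energy argument: the swing equations only have the trivial solution if the feedback
`α` does no positive work. -/
theorem freq_eq_zero_of_work_nonpos {x : StateIdx G → ℝ}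
    (hline : ∀ e, (Q.F *ᵥ x) (Sum.inl e) = 0) (hfreq : ∀ i, (Q.F *ᵥ x) (Sum.inr (Sum.inl i)) = 0)
    (hwork : ∑ i, x (Sum.inr (Sum.inl i)) * x (Sum.inr (Sum.inr i)) ≤ 0) :
    (∀ e, x (Sum.inl e) = 0) ∧ ∀ i, x (Sum.inr (Sum.inl i)) = 0 := by
  have hT := Q.T_pos
  set ω : V → ℝ := fun i => x (Sum.inr (Sum.inl i)) with hω
  set lam : G.edgeSet → ℝ := fun e => x (Sum.inl e) with hlam
  have h1 : ∀ e, lam e = Q.T * (P.incidence *ᵥ ω) e := fun e => by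
    have := hline e
    rw [F_mulVec_line] at this
    exact sub_eq_zero.1 this
  -- Since `λ = T D ω` by the line rows, the work of the line flows is a nonnegative quadratic form.
  -- In the balance of the frequency rows tested with `ω`, all terms then have the same sign.
  have h2 : ∑ i, ω i * (P.incidenceᵀ *ᵥ fun e => P.b e * lam e) i
      = ∑ e, Q.T * P.b e * (P.incidence *ᵥ ω) e ^ 2 := by
    have : ω ⬝ᵥ (P.incidenceᵀ *ᵥ fun e => P.b e * lam e)
        = (P.incidence *ᵥ ω) ⬝ᵥ fun e => P.b e * lam e := by
      rw [Matrix.dotProduct_mulVec, Matrix.vecMul_transpose]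
    rw [dotProduct, dotProduct] at this
    rw [this]
    refine Finset.sum_congr rfl fun e _ => ?_
    rw [h1 e]; ring
  have h3 : 0 ≤ ∑ e, Q.T * P.b e * (P.incidence *ᵥ ω) e ^ 2 :=
    Finset.sum_nonneg fun e _ => mul_nonneg (mul_pos hT (P.b_pos e)).le (sq_nonneg _)
  have h4 : ∑ i, ω i * (Q.F *ᵥ x) (Sum.inr (Sum.inl i)) = 0 :=
    Finset.sum_eq_zero fun i _ => by rw [hfreq i, mul_zero]
  have h5 : ∑ i, ω i * (Q.F *ᵥ x) (Sum.inr (Sum.inl i))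
      = ∑ i, (P.M i + Q.T * P.E i) * ω i ^ 2
        + Q.T * ∑ i, ω i * (P.incidenceᵀ *ᵥ fun e => P.b e * lam e) i
        - Q.T * ∑ i, ω i * x (Sum.inr (Sum.inr i)) := by
    rw [Finset.mul_sum, Finset.mul_sum, ← Finset.sum_add_distrib, ← Finset.sum_sub_distrib]
    refine Finset.sum_congr rfl fun i _ => ?_
    rw [F_mulVec_freq]
    ring
  have h6 : ∀ i ∈ Finset.univ, 0 ≤ (P.M i + Q.T * P.E i) * ω i ^ 2 := fun i _ =>
    mul_nonneg (add_nonneg (P.M_nonneg i) (mul_pos hT (P.E_pos i)).le) (sq_nonneg _)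
  have h7 : ∑ i, (P.M i + Q.T * P.E i) * ω i ^ 2 = 0 := by
    refine le_antisymm ?_ (Finset.sum_nonneg h6)
    rw [h2] at h5
    have h8 := mul_nonneg hT.le h3
    have h9 := mul_nonpos_of_nonneg_of_nonpos hT.le hwork
    linarith
  have h8 : ∀ i, ω i = 0 := fun i => by
    have := (Finset.sum_eq_zero_iff_of_nonneg h6).1 h7 i (Finset.mem_univ i)
    have hpos : 0 < P.M i + Q.T * P.E i :=
      add_pos_of_nonneg_of_pos (P.M_nonneg i) (mul_pos hT (P.E_pos i))
    simpa [hpos.ne'] using this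
  refine ⟨fun e => ?_, h8⟩
  have := h1 e
  rw [funext h8, show (fun _ : V => (0 : ℝ)) = 0 from rfl, Matrix.mulVec_zero] at this
  simpa using this

/-- On the kernel the filter is passive: `T ω_i α_i = -(M_i + T / τ_i) α_i²` at a controlled bus and
`α_i = 0` elsewhere. So the feedback does no positive work and the energy argument applies. -/
theorem F_mulVec_injective : Function.Injective Q.F.mulVec := by
  have hT := Q.T_pos
  have key : ∀ x, Q.F *ᵥ x = 0 → x = 0 := by
    intro x hx
    have hα : ∀ i, x (Sum.inr (Sum.inl i)) * x (Sum.inr (Sum.inr i)) ≤ 0 := by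
      intro i
      have h1 := congrFun hx (Sum.inr (Sum.inr i))
      rw [F_mulVec_filt, Pi.zero_apply] at h1
      split_ifs at h1 with hi
      · have h2 : 0 < P.M i + Q.T * (1 / P.τ i) :=
          add_pos_of_nonneg_of_pos (P.M_nonneg i) (mul_pos hT (one_div_pos.2 (P.τ_pos i hi)))
        have h3 : Q.T * (x (Sum.inr (Sum.inl i)) * x (Sum.inr (Sum.inr i)))
            = -((P.M i + Q.T * (1 / P.τ i)) * x (Sum.inr (Sum.inr i)) ^ 2) := by
          linear_combination x (Sum.inr (Sum.inr i)) * h1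
        have h4 := mul_nonneg h2.le (sq_nonneg (x (Sum.inr (Sum.inr i))))
        by_contra! h5
        have := mul_pos hT h5
        linarith
      · rw [mul_eq_zero, or_iff_right hT.ne'] at h1
        rw [h1, mul_zero]
    obtain ⟨hlam, hω⟩ := Q.freq_eq_zero_of_work_nonpos (fun e => congrFun hx _)
      (fun i => congrFun hx _) (Finset.sum_nonpos fun i _ => hα i)
    ext (e | i | i)
    · exact hlam e
    · exact hω i
    · have h1 := congrFun hx (Sum.inr (Sum.inr i))
      rw [F_mulVec_filt, Pi.zero_apply] at h1
      split_ifs at h1 with hi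
      · have h2 : 0 < P.M i + Q.T * (1 / P.τ i) :=
          add_pos_of_nonneg_of_pos (P.M_nonneg i) (mul_pos hT (one_div_pos.2 (P.τ_pos i hi)))
        rw [hω i, mul_zero, add_zero, mul_eq_zero, or_iff_right h2.ne'] at h1
        exact h1
      · rw [mul_eq_zero, or_iff_right hT.ne'] at h1
        exact h1
  intro x y hxy
  refine sub_eq_zero.1 (key _ ?_)
  rw [Matrix.mulVec_sub, sub_eq_zero]
  exact hxy

theorem F_mulVec_surjective : Function.Surjective Q.F.mulVec :=
  (LinearMap.injective_iff_surjective (f := Q.F.mulVecLin)).1 Q.F_mulVec_injective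

theorem B₂_mulVec (u : V → ℝ) :
    Q.B₂ *ᵥ u = Sum.elim (fun _ => 0) (Sum.elim (fun _ => 0) (Q.T • u)) := by
  ext (e | i | i) <;> simp [B₂, Bt₂, Matrix.smul_mulVec, Matrix.fromRows_mulVec]

/-- The squared residuals and costs determine the decision variables, as soon as the horizon
contains at least two prediction times. -/
theorem program_B_injective (hL : 1 ≤ L) : Function.Injective Q.program.B := by
  have hT := Q.T_pos
  refine (injective_iff_map_eq_zero _).2 fun Y hY => ?_
  have hB : ∀ a, Q.program.B Y a = 0 := fun a => congrFun hY a
  have hstep : ∀ k : Fin L, Q.F *ᵥ state Y k.succ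
      = Q.A *ᵥ state Y k.castSucc + Q.B₂ *ᵥ input Y := fun k => by
    ext j
    have : (Q.F *ᵥ state Y k.succ - Q.A *ᵥ state Y k.castSucc - Q.B₂ *ᵥ input Y) j = 0 :=
      hB (Sum.inl (k, j))
    simp only [Pi.sub_apply, Pi.add_apply] at this ⊢
    linarith
  have hfilt : ∀ k i, filt Y k i = 0 := fun k i => by
    have : √(P.c i) * filt Y k i = 0 := hB (Sum.inr (Sum.inl (k, i)))
    rwa [mul_eq_zero, or_iff_right (Real.sqrt_pos.2 (P.c_pos i)).ne'] at this
  have hslack : ∀ k i, slack Y k i = 0 := fun k i => by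
    have : √(P.d i) * slack Y k i = 0 := hB (Sum.inr (Sum.inr (Sum.inl (k, i))))
    rwa [mul_eq_zero, or_iff_right (Real.sqrt_pos.2 (P.d_pos i i.2)).ne'] at this
  have hinit : state Y 0 = 0 := funext fun j => hB (Sum.inr (Sum.inr (Sum.inr j)))
  -- The input is seen only through the model. In the first step the previous state is zero and the
  -- filter cost kills the new filter state, so the work is zero, the frequency vanishes, and each
  -- filter row reduces to `0 = T u_i`.
  have hu : input Y = 0 := by
    let k₀ : Fin L := ⟨0, hL⟩
    have h1 := hstep k₀
    have h0 : state Y k₀.castSucc = 0 := hinit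
    rw [h0, Matrix.mulVec_zero, zero_add, B₂_mulVec] at h1
    obtain ⟨-, hω⟩ := Q.freq_eq_zero_of_work_nonpos (x := state Y k₀.succ)
      (fun e => congrFun h1 _) (fun i => congrFun h1 _)
      (le_of_eq (Finset.sum_eq_zero fun i _ => by
        rw [show state Y k₀.succ (Sum.inr (Sum.inr i)) = 0 from hfilt _ i, mul_zero]))
    ext i
    have h2 := congrFun h1 (Sum.inr (Sum.inr i))
    rw [F_mulVec_filt, show state Y k₀.succ (Sum.inr (Sum.inr i)) = 0 from hfilt _ i, hω i] at h2
    simpa [hT.ne'] using h2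
  have hstate : ∀ k, state Y k = 0 := by
    intro k
    induction k using Fin.induction with
    | zero => exact hinit
    | succ k ih =>
      refine Q.F_mulVec_injective ?_
      show Q.F *ᵥ state Y k.succ = Q.F *ᵥ 0
      rw [hstep k, ih, hu, Matrix.mulVec_zero, Matrix.mulVec_zero, Matrix.mulVec_zero, add_zero]
  ext (⟨k, j⟩ | i | ⟨k, i⟩)
  · exact congrFun (hstate k) j
  · exact congrFun hu i
  · exact hslack k i

/-- The zero input meets its bounds, surjectivity of `F` allows the model to be solved step by step
from the sampled state, and slacks chosen large enough satisfy the frequency bounds. -/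
theorem exists_feasible : ∃ Y, Q.Feasible Y := by
  choose Finv hFinv using Q.F_mulVec_surjective
  let seq : Fin (L + 1) → StateIdx G → ℝ :=
    Fin.induction Q.x₀ fun k x => Finv (Q.A *ᵥ x + Q.B₁ *ᵥ Q.pf k.castSucc)
  let Y : Primal P L := WithLp.toLp 2 (Sum.elim (fun p => seq p.1 p.2) (Sum.elim (fun _ => 0)
    fun p => |seq p.1 (Sum.inr (Sum.inl p.2))| + |P.ωlo p.2| + |P.ωhi p.2|))
  have hstate : ∀ k, state Y k = seq k := fun k => rfl
  have hinput : input Y = 0 := rfl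
  have hslack : ∀ k i, slack Y k i
      = |seq k (Sum.inr (Sum.inl i))| + |P.ωlo i| + |P.ωhi i| := fun k i => rfl
  refine ⟨Y, fun k => ?_, fun i _ => rfl, rfl, fun k i => ?_, fun k i => ?_, fun i hi => ?_⟩
  · rw [hstate, hstate, hinput, Matrix.mulVec_zero, add_zero]
    exact hFinv _
  · rw [hslack]
    have := neg_abs_le (seq k (Sum.inr (Sum.inl i)))
    show _ ≤ seq k (Sum.inr (Sum.inl i))
    linarith [le_abs_self (P.ωlo i), abs_nonneg (P.ωhi i)]
  · rw [hslack]
    have := le_abs_self (seq k (Sum.inr (Sum.inl i)))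
    show seq k (Sum.inr (Sum.inl i)) ≤ _
    linarith [neg_abs_le (P.ωhi i), abs_nonneg (P.ωlo i)]
  · rw [hinput, Pi.zero_apply, abs_zero]
    exact mul_nonneg (P.ε_pos i hi).le (abs_nonneg _)

end MPCData

/-! ### Distributed structure of the dynamics -/

namespace MPCData

open PowerNetwork

variable {V : Type*} [Fintype V] [DecidableEq V] {G : SimpleGraph V}
  [DecidableRel G.Adj] {P : PowerNetwork G} {L : ℕ} (Q : MPCData P L)

omit [Fintype V] [DecidableEq V] [DecidableRel G.Adj] in
theorem edist_agent_le_one {i : V} {e : G.edgeSet} (h : i ∈ (e : Sym2 V)) :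
    (agentGraph G).edist (Sum.inl i) (Sum.inr e) ≤ 1 := by
  have hadj : (agentGraph G).Adj (Sum.inl i) (Sum.inr e) := by
    simp [agentGraph, SimpleGraph.fromRel_adj, h]
  exact (SimpleGraph.edist_eq_one_iff_adj.2 hadj).le

omit [DecidableRel G.Adj] in
theorem incidence_eq_zero {e : G.edgeSet} {i : V}
    (h : ¬(agentGraph G).edist (Sum.inl i) (Sum.inr e) ≤ 1) : P.incidence e i = 0 := by
  have h1 : i ∉ (e : Sym2 V) := fun hmem => h (edist_agent_le_one hmem)
  rw [← P.ends e, Sym2.mem_iff, not_or] at h1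
  simp [incidence, h1.1, h1.2]

/-- Rows of `F` only involve variables held by neighboring agents. -/
theorem F_mulVec_congr {x y : StateIdx G → ℝ} {j : StateIdx G}
    (h : ∀ j', (agentGraph G).edist (stateOwner j) (stateOwner j') ≤ 1 → x j' = y j') :
    (Q.F *ᵥ x) j = (Q.F *ᵥ y) j := by
  rcases j with e | i | i
  · rw [F_mulVec_line, F_mulVec_line, h _ (by simp [SimpleGraph.edist_self])]
    congr 2
    refine Finset.sum_congr rfl fun i _ => ?_
    by_cases hd : (agentGraph G).edist (Sum.inl i) (Sum.inr e) ≤ 1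
    · simp only [h (Sum.inr (Sum.inl i)) (by rw [SimpleGraph.edist_comm]; exact hd)]
    · show P.incidence e i * _ = P.incidence e i * _
      rw [incidence_eq_zero hd, zero_mul, zero_mul]
  · rw [F_mulVec_freq, F_mulVec_freq, h (Sum.inr (Sum.inl i)) (by simp [SimpleGraph.edist_self]),
      h (Sum.inr (Sum.inr i)) (by simp [stateOwner, SimpleGraph.edist_self])]
    congr 3
    refine Finset.sum_congr rfl fun e _ => ?_
    simp only [Matrix.transpose_apply]
    by_cases hd : (agentGraph G).edist (Sum.inl i) (Sum.inr e) ≤ 1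
    · rw [h (Sum.inl e) hd]
    · rw [incidence_eq_zero hd, zero_mul, zero_mul]
  · rw [F_mulVec_filt, F_mulVec_filt, h (Sum.inr (Sum.inr i)) (by simp [SimpleGraph.edist_self]),
      h (Sum.inr (Sum.inl i)) (by simp [stateOwner, SimpleGraph.edist_self])]

theorem A_mulVec_congr {x y : StateIdx G → ℝ} {j : StateIdx G} (h : x j = y j) :
    (Q.A *ᵥ x) j = (Q.A *ᵥ y) j := by
  rcases Q.A_eq with hA | hA
  · rw [hA, Gt, Matrix.mulVec_diagonal, Matrix.mulVec_diagonal, h]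
  · rw [hA, Matrix.one_mulVec, Matrix.one_mulVec, h]

/-- Only `F` couples distinct agents, through the incidence matrix. Both choices of `A` are
diagonal, and `B₂` feeds the input of a bus into the filter row of the same bus. -/
theorem modelResidual_congr {Y Y' : Primal P L} {k : Fin L} {j : StateIdx G}
    (h : ∀ i, (agentGraph G).edist (stateOwner j) (primalOwner i) ≤ 1 → Y i = Y' i) :
    Q.modelResidual Y k j = Q.modelResidual Y' k j := by
  have h1 : (Q.F *ᵥ state Y k.succ) j = (Q.F *ᵥ state Y' k.succ) j :=
    Q.F_mulVec_congr fun j' hj' => h (Sum.inl (k.succ, j')) hj'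
  have h2 : (Q.A *ᵥ state Y k.castSucc) j = (Q.A *ᵥ state Y' k.castSucc) j :=
    Q.A_mulVec_congr (h (Sum.inl (k.castSucc, j)) (by simp [primalOwner, SimpleGraph.edist_self]))
  have h3 : (Q.B₂ *ᵥ input Y) j = (Q.B₂ *ᵥ input Y') j := by
    rw [B₂_mulVec, B₂_mulVec]
    rcases j with e | i | i
    · rfl
    · rfl
    · exact congrArg (Q.T * ·) (h (Sum.inr (Sum.inl i))
        (by simp [primalOwner, stateOwner, SimpleGraph.edist_self]))
  simp only [modelResidual, Pi.sub_apply, h1, h2, h3]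

theorem eqMap_congr {Y Y' : Primal P L} {a : EqIdx P L}
    (h : ∀ i, (agentGraph G).edist (eqOwner a) (primalOwner i) ≤ 1 → Y i = Y' i) :
    Q.eqMap Y a = Q.eqMap Y' a := by
  rcases a with ⟨k, j⟩ | j | i
  · exact Q.modelResidual_congr h
  · exact congrArg (· - Q.x₀ j) (h (Sum.inl (0, j))
      (by simp [primalOwner, eqOwner, SimpleGraph.edist_self]))
  · exact h (Sum.inr (Sum.inl i)) (by simp [primalOwner, eqOwner, SimpleGraph.edist_self])

theorem ineqMap_congr {Y Y' : Primal P L} {a : IneqIdx P L}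
    (h : ∀ i, (agentGraph G).edist (ineqOwner a) (primalOwner i) ≤ 1 → Y i = Y' i) :
    Q.ineqMap Y a = Q.ineqMap Y' a := by
  rcases a with ⟨k, i, s⟩ | ⟨i, s⟩
  · have h1 : freq Y k i = freq Y' k i := h (Sum.inl (k, Sum.inr (Sum.inl i)))
      (by simp [primalOwner, stateOwner, ineqOwner, SimpleGraph.edist_self])
    have h2 : slack Y k i = slack Y' k i := h (Sum.inr (Sum.inr (k, i)))
      (by simp [primalOwner, ineqOwner, SimpleGraph.edist_self])
    cases s <;> simp only [ineqMap, h1, h2]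
  · have h1 : input Y i = input Y' i := h (Sum.inr (Sum.inl i))
      (by simp [primalOwner, ineqOwner, SimpleGraph.edist_self])
    cases s <;> simp only [ineqMap, h1]

theorem eqField_congr (a : EqIdx P L) (x y : PD P L) (h : AgreeWithin 1 (eqOwner a) x y) :
    Q.eqField x a = Q.eqField y a :=
  Q.eqMap_congr h.1

theorem ineqField_congr (a : IneqIdx P L) (x y : PD P L)
    (h : AgreeWithin 1 (ineqOwner a) x y) : Q.ineqField x a = Q.ineqField y a := by
  rw [ineqField, ineqField, Q.ineqMap_congr h.1,
    h.2.1 a (by simp [SimpleGraph.edist_self])]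

omit [DecidableRel G.Adj] in
/-- Increments, in the direction of a coordinate `i`, of a term with one-hop dependence and with a
local multiplier only depend on variables within two hops of the agent of `i`. -/
theorem mul_increment_congr {φ : Primal P L → ℝ} {o : V ⊕ G.edgeSet}
    (hφ : ∀ Y Y' : Primal P L,
      (∀ j, (agentGraph G).edist o (primalOwner j) ≤ 1 → Y j = Y' j) → φ Y = φ Y')
    (i : PrimalIdx P L) {Y Y' : Primal P L}
    (h : ∀ j, (agentGraph G).edist (primalOwner i) (primalOwner j) ≤ 2 → Y j = Y' j) {c c' : ℝ}
    (hc : (agentGraph G).edist (primalOwner i) o ≤ 2 → c = c') (t : ℝ) :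
    c * φ (Y + t • EuclideanSpace.single i 1) - c * φ Y
      = c' * φ (Y' + t • EuclideanSpace.single i 1) - c' * φ Y' := by
  -- If the owner of the term is within one hop of the agent of `i`, the triangle inequality puts
  -- all its variables within two hops. Otherwise the term does not involve coordinate `i`, and both
  -- increments vanish whatever the multipliers are.
  by_cases ho : (agentGraph G).edist o (primalOwner i) ≤ 1
  · have hY : ∀ j, (agentGraph G).edist o (primalOwner j) ≤ 1 → Y j = Y' j := fun j hj => by
      refine h j ((SimpleGraph.edist_triangle (v := o)).trans ?_)
      rw [SimpleGraph.edist_comm]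
      exact (add_le_add ho hj).trans (by norm_num)
    rw [hc (by rw [SimpleGraph.edist_comm]; exact ho.trans one_le_two), hφ Y Y' hY,
      hφ (Y + t • EuclideanSpace.single i 1) (Y' + t • EuclideanSpace.single i 1)
      fun j hj => by simp [hY j hj]]
  · have hne : ∀ Y : Primal P L, φ (Y + t • EuclideanSpace.single i 1) = φ Y := fun Y =>
      hφ _ _ fun j hj => by
        have : j ≠ i := fun hji => ho (hji ▸ hj)
        simp [this]
    rw [hne, hne, sub_self, sub_self]

/-- The agent to which a squared term of the objective function belongs. -/
def costOwner : CostIdx P L → V ⊕ G.edgeSet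
  | Sum.inl (_, j) => stateOwner j
  | Sum.inr (Sum.inl (_, i)) => Sum.inl i
  | Sum.inr (Sum.inr (Sum.inl (_, i))) => Sum.inl i
  | Sum.inr (Sum.inr (Sum.inr j)) => stateOwner j

theorem cost_congr {Y Y' : Primal P L} {a : CostIdx P L}
    (h : ∀ i, (agentGraph G).edist (costOwner a) (primalOwner i) ≤ 1 → Y i = Y' i) :
    Q.program.B Y a - Q.program.r a = Q.program.B Y' a - Q.program.r a := by
  rcases a with ⟨k, j⟩ | ⟨k, i⟩ | ⟨k, i⟩ | j
  · change Q.modelLin Y (k, j) - (Q.B₁ *ᵥ Q.pf k.castSucc) j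
      = Q.modelLin Y' (k, j) - (Q.B₁ *ᵥ Q.pf k.castSucc) j
    rw [← modelResidual_eq, ← modelResidual_eq]
    exact Q.modelResidual_congr h
  · exact congrArg (√(P.c i) * · - 0) (h (Sum.inl (k, Sum.inr (Sum.inr i)))
      (by simp [primalOwner, stateOwner, costOwner, SimpleGraph.edist_self]))
  · exact congrArg (√(P.d i) * · - 0) (h (Sum.inr (Sum.inr (k, i)))
      (by simp [primalOwner, costOwner, SimpleGraph.edist_self]))
  · exact congrArg (· - Q.x₀ j) (h (Sum.inl (0, j))
      (by simp [primalOwner, costOwner, SimpleGraph.edist_self]))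

/-- The Lagrangian itself depends on all agents. Its increments in one coordinate are local term by
term, and they suffice to determine that entry of the gradient. -/
theorem lagrangian_increment_congr (i : PrimalIdx P L) {x y : PD P L}
    (h : AgreeWithin 2 (primalOwner i) x y) (t : ℝ) :
    Q.lagrangian (x.1 + t • EuclideanSpace.single i 1) x.2.1 x.2.2 - Q.lagrangian x.1 x.2.1 x.2.2
      = Q.lagrangian (y.1 + t • EuclideanSpace.single i 1) y.2.1 y.2.2
        - Q.lagrangian y.1 y.2.1 y.2.2 := by
  simp only [lagrangian, gAug_eq, LeastSquaresProgram.obj, add_sub_add_comm,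
    ← Finset.sum_sub_distrib]
  refine congrArg₂ (· + ·) (congrArg₂ (· + ·) ?_ ?_) ?_ <;>
    refine Finset.sum_congr rfl fun a _ => ?_
  · simpa only [one_mul] using mul_increment_congr
      (φ := fun Y => (Q.program.B Y a - Q.program.r a) ^ 2) (o := costOwner a)
      (fun Y Y' hY => congrArg (· ^ 2) (Q.cost_congr hY)) i h.1 (fun _ => Eq.refl (1 : ℝ)) t
  · exact mul_increment_congr (φ := fun Y => Q.ineqMap Y a) (fun Y Y' hY => Q.ineqMap_congr hY)
      i h.1 (h.2.1 a) t
  · exact mul_increment_congr (φ := fun Y => Q.eqMap Y a) (fun Y Y' hY => Q.eqMap_congr hY)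
      i h.1 (h.2.2 a) t

theorem primalField_congr (i : PrimalIdx P L) (x y : PD P L)
    (h : AgreeWithin 2 (primalOwner i) x y) : Q.primalField x i = Q.primalField y i := by
  have key : ∀ x : PD P L, Q.primalField x i = -deriv (fun t : ℝ =>
      Q.lagrangian (x.1 + t • EuclideanSpace.single i 1) x.2.1 x.2.2
        - Q.lagrangian x.1 x.2.1 x.2.2) 0 := fun x => by
    rw [primalField_eq_lineDeriv, deriv_sub_const, lineDeriv]
  rw [key, key, funext fun t => Q.lagrangian_increment_congr i h t]

end MPCData

/-! ### Transfer to the saddle-point dynamics and conclusion -/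

namespace MPCData

open PowerNetwork LeastSquaresProgram

variable {V : Type*} [Fintype V] [DecidableEq V] {G : SimpleGraph V}
  [DecidableRel G.Adj] {P : PowerNetwork G} {L : ℕ} (Q : MPCData P L)

/-- All primal and dual coordinates as a single vector. -/
def pack (x : PD P L) : PrimalIdx P L ⊕ IneqIdx P L ⊕ EqIdx P L → ℝ :=
  Sum.elim x.1 (Sum.elim x.2.1 x.2.2)

/-- The inverse of `pack`. -/
noncomputable def unpack (z : PrimalIdx P L ⊕ IneqIdx P L ⊕ EqIdx P L → ℝ) : PD P L :=
  (primalPart z, WithLp.toLp 2 (ineqPart z), WithLp.toLp 2 (eqPart z))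

omit [DecidableRel G.Adj] in
theorem unpack_pack (x : PD P L) : unpack (pack x) = x := rfl

omit [DecidableRel G.Adj] in
theorem pack_unpack (z : PrimalIdx P L ⊕ IneqIdx P L ⊕ EqIdx P L → ℝ) : pack (unpack z) = z := by
  ext (_ | _ | _) <;> rfl

omit [DecidableRel G.Adj] in
theorem continuous_pack : Continuous (pack : PD P L → _) := by
  refine continuous_pi ?_
  rintro (i | i | i) <;> simp only [pack, Sum.elim_inl, Sum.elim_inr] <;> fun_prop

theorem continuous_unpack : Continuous (unpack : _ → PD P L) := by
  refine continuous_primalPart.prodMk (Continuous.prodMk ?_ ?_)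
  · exact (PiLp.continuous_toLp 2 _).comp (continuous_pi fun i => continuous_apply _)
  · exact (PiLp.continuous_toLp 2 _).comp (continuous_pi fun i => continuous_apply _)

theorem isSaddle_unpack_iff (z : PrimalIdx P L ⊕ IneqIdx P L ⊕ EqIdx P L → ℝ) :
    Q.IsSaddle (unpack z) ↔ Q.program.KKT (primalPart z) (ineqPart z) (eqPart z) :=
  Q.isSaddle_iff _

theorem projField_pack {εη : ℝ} (hη : 0 < εη) (εZ εμ : ℝ) (x : PD P L) :
    projField (ineqCoords _ _ _) (Q.program.flowField εZ εη εμ) (pack x)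
      = Sum.elim (fun i => εZ⁻¹ * Q.primalField x i)
        (Sum.elim (fun i => εη⁻¹ * Q.ineqField x i) (fun i => εμ⁻¹ * Q.eqField x i)) := by
  ext (i | i | i)
  · have h : (Sum.inl i : PrimalIdx P L ⊕ IneqIdx P L ⊕ EqIdx P L) ∉ ineqCoords _ _ _ := by
      simp [ineqCoords]
    simp only [projField, h, if_false, Sum.elim_inl, primalField_eq]
    rfl
  · have h : (Sum.inr (Sum.inl i) : PrimalIdx P L ⊕ IneqIdx P L ⊕ EqIdx P L) ∈ ineqCoords _ _ _ :=
      ⟨i, rfl⟩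
    simp only [projField, h, if_true, Sum.elim_inl, Sum.elim_inr, ineqField, ineqMap_eq]
    exact posProj_mul (inv_pos.2 hη) _ _
  · have h : (Sum.inr (Sum.inr i) : PrimalIdx P L ⊕ IneqIdx P L ⊕ EqIdx P L)
        ∉ ineqCoords _ _ _ := by
      simp [ineqCoords]
    simp only [projField, h, if_false, Sum.elim_inr, eqField, eqMap_eq]
    rfl

theorem isTrajectory_iff {εη : ℝ} (hη : 0 < εη) (εZ εμ : ℝ) (x : ℝ → PD P L) :
    Q.IsTrajectory εZ εη εμ x ↔
      IsProjTrajectory (ineqCoords _ _ _) (Q.program.flowField εZ εη εμ) fun t => pack (x t) := by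
  constructor
  · intro h
    refine ⟨?_, ?_, ?_⟩
    · rintro _ ⟨i, rfl⟩
      exact h.init i
    · rintro (i | i | i)
      · exact h.ac_primal i
      · exact h.ac_ineq i
      · exact h.ac_eq i
    · simp only [Q.projField_pack hη]
      rintro (i | i | i)
      · exact h.ode_primal i
      · exact h.ode_ineq i
      · exact h.ode_eq i
  · intro h
    have hode := h.ode
    simp only [Q.projField_pack hη] at hode
    exact ⟨fun i => h.init _ ⟨i, rfl⟩, fun i => h.ac (Sum.inl i),
      fun i => h.ac (Sum.inr (Sum.inl i)),
      fun i => h.ac (Sum.inr (Sum.inr i)), fun i => hode (Sum.inl i),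
      fun i => hode (Sum.inr (Sum.inl i)), fun i => hode (Sum.inr (Sum.inr i))⟩

theorem exists_isTrajectory {εη : ℝ} (hη : 0 < εη) (εZ εμ : ℝ) (x₀ : PD P L)
    (hx₀ : ∀ i, 0 ≤ x₀.2.1 i) : ∃ x, Q.IsTrajectory εZ εη εμ x ∧ x 0 = x₀ := by
  obtain ⟨K, hK⟩ := Q.program.exists_lipschitzWith_flowField εZ εη εμ
  obtain ⟨x, hx, hx0⟩ := exists_isProjTrajectory (ineqCoords _ _ _) hK (pack x₀) (by
    rintro _ ⟨i, rfl⟩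
    exact hx₀ i)
  refine ⟨fun t => unpack (x t), (Q.isTrajectory_iff hη _ _ _).2 ?_, ?_⟩
  · simpa only [pack_unpack] using hx
  · simp only [hx0, unpack_pack]

theorem exists_tendsto_saddle (hL : 1 ≤ L) {εZ εη εμ : ℝ} (hZ : 0 < εZ) (hη : 0 < εη)
    (hμ : 0 < εμ) {y : PD P L} (hy : Q.IsSaddle y) {x : ℝ → PD P L}
    (hx : Q.IsTrajectory εZ εη εμ x) :
    ∃ η μ, Q.IsSaddle (y.1, η, μ) ∧ Tendsto x atTop (𝓝 (y.1, η, μ)) := by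
  obtain ⟨z, hz, hkkt, hlim⟩ := Q.program.exists_tendsto_of_trajectory
    (Q.program_B_injective hL) hZ hη hμ (y := pack y) ((Q.isSaddle_iff y).1 hy)
    ((Q.isTrajectory_iff hη _ _ _).1 hx)
  have hz' : unpack z = (y.1, (unpack z).2.1, (unpack z).2.2) := Prod.ext hz rfl
  refine ⟨(unpack z).2.1, (unpack z).2.2, ?_, ?_⟩
  · rw [← hz']
    exact (Q.isSaddle_unpack_iff z).2 hkkt
  · rw [← hz']
    exact (continuous_unpack.tendsto z).comp hlim

theorem IsSaddle.stable {Q : MPCData P L} {εZ εη εμ : ℝ} (hZ : 0 < εZ) (hη : 0 < εη)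
    (hμ : 0 < εμ) {y : PD P L} (hy : Q.IsSaddle y) {ρ : ℝ} (hρ : 0 < ρ) :
    ∃ δ > 0, ∀ x, Q.IsTrajectory εZ εη εμ x → dist (x 0) y < δ →
      ∀ t, 0 ≤ t → dist (x t) y < ρ := by
  have hkkt : Q.program.KKT (primalPart (pack y)) (ineqPart (pack y)) (eqPart (pack y)) :=
    (Q.isSaddle_iff y).1 hy
  -- The flat coordinates carry the sup norm and the primal-dual triple a product of Euclidean
  -- norms; continuity of `unpack` and `pack` converts the radii.
  obtain ⟨ρ', hρ', h1⟩ := Metric.continuousAt_iff.1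
    (continuous_unpack.continuousAt (x := pack y)) ρ hρ
  obtain ⟨δ', hδ', h2⟩ := exists_forall_dist_lt (timeScales_pos hZ hη hμ)
    (fun _ hz => Q.program.flow_dissipation_nonpos hZ hη hμ hkkt hz) hρ'
  obtain ⟨δ, hδ, h3⟩ := Metric.continuousAt_iff.1 (continuous_pack.continuousAt (x := y)) δ' hδ'
  refine ⟨δ, hδ, fun x hx h0 t ht => ?_⟩
  have h4 := h1 (h2 _ ((Q.isTrajectory_iff hη _ _ _).1 hx) (h3 h0) t ht)
  rwa [unpack_pack, unpack_pack] at h4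

theorem exists_optimal_saddle (hL : 1 ≤ L) :
    ∃ Y η μ, Q.IsOptimal Y ∧ (∀ Y', Q.IsOptimal Y' → Y' = Y) ∧ Q.IsSaddle (Y, η, μ) := by
  have hB := Q.program_B_injective hL
  obtain ⟨Y₀, hY₀⟩ := Q.exists_feasible
  obtain ⟨Y, hY, hmin⟩ := Q.program.exists_optimal hB ((Q.feasible_iff Y₀).1 hY₀)
  obtain ⟨η, μ, hkkt⟩ := Q.program.exists_kkt hY hmin
  refine ⟨Y, WithLp.toLp 2 η, WithLp.toLp 2 μ, ⟨(Q.feasible_iff Y).2 hY, fun Y' hY' => ?_⟩,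
    fun Y' hY' => ?_, (Q.isSaddle_iff _).2 hkkt⟩
  · rw [gAug_eq, gAug_eq]
    exact hmin Y' ((Q.feasible_iff Y').1 hY')
  · have h1 := hkkt.obj_add_le ((Q.feasible_iff Y').1 hY'.1)
    have h2 := hY'.2 Y ((Q.feasible_iff Y).2 hY)
    rw [gAug_eq, gAug_eq] at h2
    have h3 : ∑ a, Q.program.B (Y' - Y) a ^ 2 = 0 :=
      le_antisymm (by linarith) (Finset.sum_nonneg fun _ _ => sq_nonneg _)
    rw [Finset.sum_eq_zero_iff_of_nonneg fun _ _ => sq_nonneg _] at h3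
    refine sub_eq_zero.1 (hB ?_)
    rw [map_zero]
    ext a
    exact pow_eq_zero_iff two_ne_zero |>.1 (h3 a (Finset.mem_univ a))

end MPCData

theorem theoremV2 {V : Type*} [Fintype V] [DecidableEq V] {G : SimpleGraph V}
    [DecidableRel G.Adj] (P : PowerNetwork G) (L : ℕ) (hL : 1 ≤ L) (Q : MPCData P L)
    (εZ εη εμ : ℝ) (hεZ : 0 < εZ) (hεη : 0 < εη) (hεμ : 0 < εμ) :
    -- the objective function is strongly convex
    (∃ m : ℝ, 0 < m ∧ StrongConvexOn Set.univ m Q.gAug) ∧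
    -- there is a unique optimal solution, and it is the primal part of a saddle point
    (∃ Ystar : MPCData.Primal P L,
      Q.IsOptimal Ystar ∧ (∀ Y, Q.IsOptimal Y → Y = Ystar) ∧
      -- the dynamics have a solution on `[0, ∞)` from every initial condition
      (∀ x₀ : MPCData.PD P L, (∀ i, 0 ≤ x₀.2.1 i) →
        ∃ x, Q.IsTrajectory εZ εη εμ x ∧ x 0 = x₀) ∧
      -- along every solution, the primal variable converges to the optimal solution and the
      -- multipliers converge to optimal multipliers
      (∀ x, Q.IsTrajectory εZ εη εμ x →
        Filter.Tendsto (fun t => (x t).1) Filter.atTop (nhds Ystar) ∧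
        ∃ (ηstar : MPCData.IneqDual P L) (μstar : MPCData.EqDual P L),
          Q.IsSaddle (Ystar, ηstar, μstar) ∧
          Filter.Tendsto x Filter.atTop (nhds (Ystar, ηstar, μstar)))) ∧
    -- every saddle point is Lyapunov stable
    (∀ xstar, Q.IsSaddle xstar → ∀ ρ > 0, ∃ δ > 0, ∀ x, Q.IsTrajectory εZ εη εμ x →
      dist (x 0) xstar < δ → ∀ t, 0 ≤ t → dist (x t) xstar < ρ) ∧
    -- the dynamics are distributed: primal variables need 2-hop communication, and the
    -- multipliers need 1-hop communication
    (∀ i x y, MPCData.AgreeWithin 2 (MPCData.primalOwner i) x y →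
      Q.primalField x i = Q.primalField y i) ∧
    (∀ i x y, MPCData.AgreeWithin 1 (MPCData.ineqOwner i) x y →
      Q.ineqField x i = Q.ineqField y i) ∧
    (∀ i x y, MPCData.AgreeWithin 1 (MPCData.eqOwner i) x y →
      Q.eqField x i = Q.eqField y i) := by
  have hconv : ∃ m : ℝ, 0 < m ∧ StrongConvexOn Set.univ m Q.gAug := by
    obtain ⟨m, hm, hmB⟩ := Q.program.exists_mul_norm_sq_le (Q.program_B_injective hL)
    refine ⟨2 * m, by positivity, ?_⟩
    rw [show Q.gAug = Q.program.obj from funext Q.gAug_eq]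
    exact Q.program.strongConvexOn_obj hmB
  obtain ⟨Y, η, μ, hopt, huniq, hsaddle⟩ := Q.exists_optimal_saddle hL
  refine ⟨hconv, ⟨Y, hopt, huniq, fun x₀ hx₀ => Q.exists_isTrajectory hεη εZ εμ x₀ hx₀,
    fun x hx => ?_⟩, fun y hy ρ hρ => hy.stable hεZ hεη hεμ hρ, Q.primalField_congr,
    Q.ineqField_congr, Q.eqField_congr⟩
  obtain ⟨η', μ', hs, hlim⟩ := Q.exists_tendsto_saddle hL hεZ hεη hεμ hsaddle hx
  exact ⟨(continuous_fst.tendsto _).comp hlim, η', μ', hs, hlim⟩
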